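/- For probability distributions $p,q$ on a measurable space $X$, let $\|p-q\|_1 = 2\sup_B |p(B)-q(B)|$, the supremum being over all measurable sets $B$ (this is $\int |p-q|$ when $p,q$ have densities), and for a class $\mathcal F$ of distributions let $\mathrm{opt}(\mathcal F,g)=\inf_{f\in\mathcal F}\|f-g\|_1$. A distribution learning method is a map which, given $\varepsilon$, $\delta$ and a finite sample of points of $X$, outputs (measurably in the sample) a probability distribution on $X$. It is a $C$-agnostic PAC-learner for $\mathcal F$ with sample complexity $m(\varepsilon,\delta)\in\mathbb N$ if for every probability distribution $g$ on $X$ (not necessarily in $\mathcal F$) and all $\varepsilon,\delta>0$, given $\varepsilon$, $\delta$ and an i.i.d. sample of size $m(\varepsilon,\delta)$ from $g$, with probability at least $1-\delta$ it outputs a distribution $\hat g$ with $$\|\hat g-g\|_1\le C\cdot\mathrm{opt}(\mathcal F,g)+\varepsilon .$$ **Theorem.** There is a universal constant $K>0$ such that, for every $d$, the class $\mathcal F$ of all $d$-dimensional Gaussian distributions $\mathcal N_d(\mu,\Sigma)$ on $\mathbb R^d$ (with arbitrary mean $\mu\in\mathbb R^d$ and arbitrary positive definite covariance matrix $\Sigma$)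 has a $3$-agnostic PAC-learner with some sample complexity $m$ satisfying $$m(\varepsilon,\delta)\;\le\; K\,\frac{d^2+\log(1/\delta)}{\varepsilon^2}\qquad\text{for all }\varepsilon>0,\ 0<\delta<1 .$$ That is, $\mathcal F$ is $3$-agnostic PAC-learnable with $O((d^2+\log(1/\delta))/\varepsilon^2)$ samples. -/

import Mathlib

open MeasureTheory ProbabilityTheory

namespace DistLearn

noncomputable section

/-- Total variation distance of two probability distributions:
the supremum of `|p(B) - q(B)|` over all measurable sets `B`. -/
def tvDist {X : Type*} [MeasurableSpace X] (p q : ProbabilityMeasure X) : ℝ :=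
  ⨆ B : {B : Set X // MeasurableSet B},
    |(p : Measure X).real B.1 - (q : Measure X).real B.1|

/-- The `L¹` distance of two probability distributions, which is twice their total variation
distance. It is the integral of `|p - q|` if they have densities, and this form also makes sense
for distributions that have no density. -/
def l1Dist {X : Type*} [MeasurableSpace X] (p q : ProbabilityMeasure X) : ℝ :=
  2 * tvDist p q

/-- `opt(F, g)`: the infimum of the `L¹` distances of `g` to the members of the class `F`. -/
def opt {X : Type*} [MeasurableSpace X] (F : Set (ProbabilityMeasure X))
    (g : ProbabilityMeasure X) : ℝ :=
  ⨅ f : F, l1Dist f.1 g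

/-- `p` is an `(ε, C)`-approximation of `g` with respect to the class `F`. -/
def IsApproximation {X : Type*} [MeasurableSpace X] (F : Set (ProbabilityMeasure X))
    (ε C : ℝ) (p g : ProbabilityMeasure X) : Prop :=
  l1Dist p g ≤ C * opt F g + ε

/-- A distribution learning method: given `ε`, `δ` and a finite sample of points of `X`, it outputs
a probability distribution on `X`, measurably in the sample. -/
structure Learner (X : Type*) [MeasurableSpace X] where
  /-- the output on the parameters `ε`, `δ` and a sample of size `m` -/
  output : ℝ → ℝ → (m : ℕ) → (Fin m → X) → ProbabilityMeasure X
  measurable_output : ∀ (ε δ : ℝ) (m : ℕ),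
    Measurable fun S : Fin m → X => (output ε δ m S : Measure X)

/-- `L` is a `C`-agnostic PAC-learner for `F` with sample complexity `m`: for every distribution `g`
(in `F` or not) and all `ε, δ > 0`, on an i.i.d. sample of size `m ε δ` from `g`, the probability
that the output fails to be an `(ε, C)`-approximation of `g` is at most `δ`. -/
def IsAgnosticPACLearner {X : Type*} [MeasurableSpace X] (C : ℝ) (F : Set (ProbabilityMeasure X))
    (L : Learner X) (m : ℝ → ℝ → ℕ) : Prop :=
  ∀ (g : ProbabilityMeasure X) (ε δ : ℝ), 0 < ε → 0 < δ →
    (Measure.pi fun _ : Fin (m ε δ) => (g : Measure X))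
      {S | ¬ IsApproximation F ε C (L.output ε δ (m ε δ) S) g} ≤ ENNReal.ofReal δ

/-- `F` is `C`-agnostic PAC-learnable with sample complexity `m`. -/
def AgnosticPACLearnable {X : Type*} [MeasurableSpace X] (C : ℝ) (F : Set (ProbabilityMeasure X))
    (m : ℝ → ℝ → ℕ) : Prop :=
  ∃ L : Learner X, IsAgnosticPACLearner C F L m

/-- The class of `d`-dimensional Gaussians `N(μ, S)`, with arbitrary mean vector `μ` and arbitrary
positive definite covariance matrix `S` (so that they have a density on `ℝᵈ`). -/
def gaussians (d : ℕ) : Set (ProbabilityMeasure (EuclideanSpace ℝ (Fin d))) :=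
  {f | ∃ (μ : EuclideanSpace ℝ (Fin d)) (S : Matrix (Fin d) (Fin d) ℝ),
    S.PosDef ∧ (f : Measure (EuclideanSpace ℝ (Fin d))) = multivariateGaussian μ S}

end

end DistLearn

/-! The learner is Yatracos' minimum distance estimate. Fix a countable subset `f 0, f 1, ...` of
the class that is dense in total variation, and let `A` enumerate the Yatracos sets on which one of
their densities exceeds another. Total variation between two members is attained on such a set. If
every empirical frequency on these sets is uniformly close to the `g`-probability, then a member `f
k` that almost minimizes the largest deviation from the empirical frequencies satisfies, for every
`f l`, up to multiples of `ε`, `tvDist (f k) g ≤ tvDist (f k) (f l) + tvDist (f l) g ≤ 3 * tvDist (f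
l) g`. This is `exists_learner_of_vcDimLE`.

For Gaussians the logarithm of a density is a quadratic polynomial, so a Yatracos set is the
positivity set of a function from a space spanned by `(d + 1) ^ 2` monomials. By a linear dependence
argument (`vcDimLE_setOf_pos`) the VC dimension is at most `(d + 1) ^ 2`.

It remains to prove uniform convergence at rate `√((D + log (1 / δ)) / n)` for VC dimension `D`,
with no factor `log n` (`measure_exists_empFreq_sub_gt_le_of_vcDimLE`). A union bound over Sauer's
count would lose that factor. Instead, a ghost sample and random swaps reduce the problem to a
Rademacher process on `2 * n` fixed points, which is controlled by chaining
(`card_exists_boolSign_gt_le`) along nets whose size, by Dudley's bound `card_le_of_separated`, does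
not depend on `n`. -/

namespace Finset

/-! ### Finite set families: Sauer's lemma, packing and covering numbers. -/

open scoped symmDiff

/-- Sauer's lemma in exponential form. -/
lemma card_le_of_vcDim_le {α : Type*} [DecidableEq α] [Fintype α] {𝒜 : Finset (Finset α)} {D : ℕ}
    (hD : 𝒜.vcDim ≤ D) {x : ℝ} (hx : 0 < x) (hx1 : x ≤ 1) :
    (#𝒜 : ℝ) ≤ (1 / x) ^ D * Real.exp (x * Fintype.card α) := by
  set c := Fintype.card α
  have h1 : #𝒜 ≤ ∑ k ∈ Iic D, c.choose k :=
    (card_le_card_shatterer 𝒜).trans <| card_shatterer_le_sum_vcDim.trans <|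
      sum_le_sum_of_subset (Iic_subset_Iic.2 hD)
  -- The weight `(1 / x) ^ D * x ^ k` is at least `1` for `k ≤ D`; after inserting it, the sum is
  -- bounded by the full binomial expansion of `(x + 1) ^ c`.
  have h2 : ∀ k ∈ Iic D, (c.choose k : ℝ) ≤ (1 / x) ^ D * (x ^ k * c.choose k) := by
    intro k hk
    have : 1 ≤ (1 / x) ^ D * x ^ k := by
      rw [one_div, inv_pow, ← div_eq_inv_mul, one_le_div (by positivity)]
      exact pow_le_pow_of_le_one hx.le hx1 (mem_Iic.1 hk)
    rw [← mul_assoc]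
    exact le_mul_of_one_le_left (by positivity) this
  have h3 : ∑ k ∈ Iic D, x ^ k * (c.choose k : ℝ) ≤ (x + 1) ^ c := by
    rw [add_pow]
    simp only [one_pow, mul_one]
    calc ∑ k ∈ Iic D, x ^ k * (c.choose k : ℝ)
        ≤ ∑ k ∈ Iic D ∪ range (c + 1), x ^ k * (c.choose k : ℝ) :=
          sum_le_sum_of_subset_of_nonneg subset_union_left fun _ _ _ => by positivity
      _ = ∑ k ∈ range (c + 1), x ^ k * (c.choose k : ℝ) := by
          symm
          refine sum_subset subset_union_right fun k _ hk => ?_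
          rw [Nat.choose_eq_zero_of_lt (by simpa using hk)]
          simp
  calc (#𝒜 : ℝ) ≤ ∑ k ∈ Iic D, (c.choose k : ℝ) := by exact_mod_cast h1
    _ ≤ ∑ k ∈ Iic D, (1 / x) ^ D * (x ^ k * c.choose k) := sum_le_sum h2
    _ ≤ (1 / x) ^ D * (x + 1) ^ c := by rw [← mul_sum]; gcongr
    _ ≤ (1 / x) ^ D * Real.exp (x * c) := by
        gcongr
        rw [mul_comm, Real.exp_nat_mul]
        gcongr
        exact Real.add_one_le_exp x

/-- The family of preimages of the members of `𝒜` under `s`. -/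
def comapFamily {α β : Type*} [DecidableEq α] [DecidableEq β] [Fintype β]
    (s : β → α) (𝒜 : Finset (Finset α)) : Finset (Finset β) :=
  𝒜.image fun a => univ.filter fun i => s i ∈ a

/-- On a shattered index set `s` is injective, since traces that are singletons separate its points;
so the image under `s` has the same size and is shattered by `𝒜`. -/
lemma vcDim_comapFamily_le {α β : Type*} [DecidableEq α] [DecidableEq β] [Fintype β]
    (s : β → α) (𝒜 : Finset (Finset α)) : (comapFamily s 𝒜).vcDim ≤ 𝒜.vcDim := by
  refine Finset.sup_le fun t ht => ?_
  rw [mem_shatterer] at ht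
  have key : ∀ u ⊆ t, ∃ a ∈ 𝒜, ∀ i ∈ t, s i ∈ a ↔ i ∈ u := by
    intro u hu
    obtain ⟨b, hb, hbt⟩ := ht hu
    obtain ⟨a, ha, rfl⟩ := mem_image.1 hb
    refine ⟨a, ha, fun i hi => ?_⟩
    rw [← hbt]
    simp [hi]
  have hinj : Set.InjOn s t := by
    intro i hi j hj hij
    obtain ⟨a, -, h⟩ := key {i} (by simpa using hi)
    have h1 := (h i hi).2 (by simp)
    rw [hij] at h1
    exact (mem_singleton.1 ((h j hj).1 h1)).symm
  rw [← card_image_of_injOn hinj]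
  refine Shatters.card_le_vcDim fun u hu => ?_
  obtain ⟨a, ha, h⟩ := key (t.filter fun i => s i ∈ u) (filter_subset _ _)
  refine ⟨a, ha, ?_⟩
  ext x
  simp only [mem_inter, mem_image]
  constructor
  · rintro ⟨⟨i, hi, rfl⟩, hx⟩
    simpa [hi] using (h i hi).1 hx
  · intro hx
    obtain ⟨i, hi, rfl⟩ := mem_image.1 (hu hx)
    exact ⟨⟨i, hi, rfl⟩, (h i hi).2 (by simp [hi, hx])⟩

/-- A large enough random sample distinguishes the members of a separated family. -/
lemma exists_sample_of_separated {α : Type*} [DecidableEq α] [Fintype α] [Nonempty α]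
    {𝒜 : Finset (Finset α)} (hne : 𝒜.Nonempty) {r : ℝ} (hr1 : r ≤ 1)
    (hsep : ∀ a ∈ 𝒜, ∀ b ∈ 𝒜, a ≠ b → r * Fintype.card α < #(a ∆ b)) {k : ℕ}
    (hk : 2 * Real.log #𝒜 ≤ r * k) :
    ∃ s : Fin k → α, ∀ a ∈ 𝒜, ∀ b ∈ 𝒜, a ≠ b → ∃ i, s i ∈ a ∆ b := by
  by_contra! hcon
  set M := Fintype.card α with hM
  have hMpos : (0 : ℝ) < M := by exact_mod_cast Fintype.card_pos
  have hN : (1 : ℝ) ≤ #𝒜 := by exact_mod_cast hne.card_pos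
  have hcover : (univ : Finset (Fin k → α)) ⊆
      𝒜.offDiag.biUnion fun p => Fintype.piFinset fun _ => (p.1 ∆ p.2)ᶜ := by
    intro s _
    obtain ⟨a, ha, b, hb, hab, h⟩ := hcon s
    simp only [mem_biUnion, mem_offDiag, Fintype.mem_piFinset, mem_compl]
    exact ⟨(a, b), ⟨ha, hb, hab⟩, h⟩
  -- Probabilistic method by counting: if every sample fails, the samples missing some `a ∆ b` cover
  -- everything.
  have h1 : (M : ℝ) ^ k ≤ ∑ p ∈ 𝒜.offDiag, ((1 - r) * M) ^ k := by
    have := (card_le_card hcover).trans card_biUnion_le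
    rw [card_univ, Fintype.card_fun, Fintype.card_fin] at this
    calc (M : ℝ) ^ k ≤ ∑ p ∈ 𝒜.offDiag,
          ((#(Fintype.piFinset fun _ : Fin k => (p.1 ∆ p.2)ᶜ) : ℕ) : ℝ) := by exact_mod_cast this
      _ ≤ _ := by
        refine sum_le_sum fun p hp => ?_
        rw [mem_offDiag] at hp
        rw [Fintype.card_piFinset, prod_const, card_univ, Fintype.card_fin, Nat.cast_pow]
        gcongr
        have h2 := hsep _ hp.1 _ hp.2.1 hp.2.2
        have h3 : (#(p.1 ∆ p.2)ᶜ : ℝ) + #(p.1 ∆ p.2) = M := by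
          exact_mod_cast card_compl_add_card (p.1 ∆ p.2)
        linarith
  rw [sum_const, nsmul_eq_mul, offDiag_card, Nat.cast_sub (Nat.le_mul_self _), Nat.cast_mul] at h1
  have h4 : (#𝒜 : ℝ) * #𝒜 * Real.exp (-(r * k)) ≤ 1 := by
    have : (#𝒜 : ℝ) * #𝒜 = Real.exp (2 * Real.log #𝒜) := by
      rw [two_mul, Real.exp_add, Real.exp_log (by linarith)]
    rw [this, ← Real.exp_add, Real.exp_le_one_iff]
    linarith
  have h5 : ((1 - r) * M) ^ k ≤ Real.exp (-(r * k)) * (M : ℝ) ^ k := by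
    rw [mul_pow, show -(r * k) = k * (-r) by ring, Real.exp_nat_mul]
    have : 0 ≤ 1 - r := by linarith
    gcongr
    exact Real.one_sub_le_exp_neg r
  have hMk : 0 < (M : ℝ) ^ k := by positivity
  have he := Real.exp_pos (-(r * k))
  have hp : 0 < Real.exp (-(r * k)) * (M : ℝ) ^ k := by positivity
  -- There are `N * N - N` ordered pairs, strictly fewer than the `N * N` that `h4` allows, whence
  -- the contradiction.
  nlinarith [mul_le_mul_of_nonneg_left h5 (show 0 ≤ (#𝒜 : ℝ) * #𝒜 - #𝒜 by nlinarith)]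

/-- Dudley's bound on the cardinality of a separated family of bounded VC dimension. -/
lemma card_le_of_separated {α : Type*} [DecidableEq α] [Fintype α] [Nonempty α]
    {𝒜 : Finset (Finset α)} {D : ℕ} (hD : 𝒜.vcDim ≤ D) {r : ℝ} (hr : 0 < r) (hr1 : r ≤ 1)
    (hsep : ∀ a ∈ 𝒜, ∀ b ∈ 𝒜, a ≠ b → r * Fintype.card α < #(a ∆ b)) :
    (#𝒜 : ℝ) ≤ 2 * (4 / r) ^ (2 * D) := by
  rcases 𝒜.eq_empty_or_nonempty with rfl | hne
  · simp; positivity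
  set N := (#𝒜 : ℝ) with hNdef
  have hN : 1 ≤ N := by rw [hNdef]; exact_mod_cast hne.card_pos
  set k := ⌈2 * Real.log N / r⌉₊ with hk
  have hk1 : 2 * Real.log N ≤ r * k := by
    have := Nat.le_ceil (2 * Real.log N / r)
    rw [div_le_iff₀ hr] at this
    linarith
  have hk2 : r * k ≤ 2 * Real.log N + r := by
    have := (Nat.ceil_lt_add_one (a := 2 * Real.log N / r)
      (by have := Real.log_nonneg hN; positivity)).le
    have h := mul_le_mul_of_nonneg_left this hr.le
    rwa [mul_add, mul_one, mul_div_cancel₀ _ hr.ne'] at h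
  obtain ⟨s, hs⟩ := exists_sample_of_separated hne hr1 hsep hk1
  have hcard : #(comapFamily s 𝒜) = #𝒜 := by
    refine card_image_of_injOn fun a ha b hb hab => ?_
    by_contra hne
    obtain ⟨i, hi⟩ := hs a ha b hb hne
    have := Finset.ext_iff.1 hab i
    simp only [mem_filter, mem_univ, true_and] at this
    rw [mem_symmDiff] at hi
    tauto
  -- With `x = r / 4` the exponential factor is at most `√N * exp (1 / 4)`, so half of `log N` is
  -- absorbed into the left side.
  have h1 := card_le_of_vcDim_le ((vcDim_comapFamily_le s 𝒜).trans hD) (x := r / 4)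
    (by positivity) (by linarith)
  rw [hcard, Fintype.card_fin, ← hNdef, one_div_div] at h1
  have h2 : Real.exp (r / 4 * k) ≤ Real.exp (Real.log N / 2) * Real.exp (1 / 4) := by
    rw [← Real.exp_add]
    gcongr
    linarith
  have h3 : Real.exp (Real.log N / 2) ^ 2 = N := by
    rw [← Real.exp_nat_mul]
    push_cast
    rw [mul_div_cancel₀ _ (by norm_num), Real.exp_log (by linarith)]
  have h4 : Real.exp (1 / 4) ^ 2 ≤ 2 := by
    rw [← Real.exp_nat_mul]
    have := Real.exp_bound_div_one_sub_of_interval (x := 1 / 2) (by norm_num) (by norm_num)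
    norm_num at this ⊢
    exact this
  set y := Real.exp (Real.log N / 2)
  have hy : 0 < y := Real.exp_pos _
  have h5 : y ≤ (4 / r) ^ D * Real.exp (1 / 4) := by
    have : y * y ≤ (4 / r) ^ D * Real.exp (1 / 4) * y := by
      calc y * y = N := by rw [← h3]; ring
        _ ≤ _ := h1.trans (by
          calc _ ≤ (4 / r) ^ D * (y * Real.exp (1 / 4)) := by gcongr
            _ = _ := by ring)
    exact le_of_mul_le_mul_right this hy
  calc N = y ^ 2 := h3.symm
    _ ≤ ((4 / r) ^ D * Real.exp (1 / 4)) ^ 2 := by gcongr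
    _ = Real.exp (1 / 4) ^ 2 * (4 / r) ^ (2 * D) := by ring
    _ ≤ _ := by gcongr

/-- A separated subfamily of maximal cardinality is a net, and Dudley's bound limits its size. -/
lemma exists_cover_of_vcDim_le {α : Type*} [DecidableEq α] [Fintype α] [Nonempty α]
    {𝒜 : Finset (Finset α)} {D : ℕ} (hD : 𝒜.vcDim ≤ D) {r : ℝ} (hr : 0 < r) (hr1 : r ≤ 1) :
    ∃ 𝒞 : Finset (Finset α), (#𝒞 : ℝ) ≤ 2 * (4 / r) ^ (2 * D) ∧
      ∀ a ∈ 𝒜, ∃ c ∈ 𝒞, (#(a ∆ c) : ℝ) ≤ r * Fintype.card α := by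
  classical
  let P := 𝒜.powerset.filter fun 𝒞 =>
    ∀ a ∈ 𝒞, ∀ b ∈ 𝒞, a ≠ b → r * Fintype.card α < #(a ∆ b)
  obtain ⟨𝒞, h𝒞, hmax⟩ := P.exists_max_image card ⟨∅, by simp [P]⟩
  simp only [P, mem_filter, mem_powerset] at h𝒞 hmax
  refine ⟨𝒞, card_le_of_separated ((vcDim_mono h𝒞.1).trans hD) hr hr1 h𝒞.2, fun a ha => ?_⟩
  by_contra! hcon
  have hnot : a ∉ 𝒞 := fun h => by
    have := hcon a h
    rw [symmDiff_self] at this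
    simp at this
    have : 0 < r * Fintype.card α := by positivity
    linarith
  have := hmax (insert a 𝒞) ⟨insert_subset ha h𝒞.1, ?_⟩
  · rw [card_insert_of_notMem hnot] at this
    omega
  · intro b hb c hc hbc
    rw [mem_insert] at hb hc
    rcases hb with rfl | hb <;> rcases hc with rfl | hc
    · exact absurd rfl hbc
    · exact hcon c hc
    · rw [symmDiff_comm]; exact hcon b hb
    · exact h𝒞.2 b hb c hc hbc

end Finset

/-! ### Chaining for Rademacher sums. -/

namespace DistLearn

open Finset
open scoped symmDiff

/-- The sign encoded by a Boolean. -/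
noncomputable def boolSign (b : Bool) : ℝ := if b then 1 else -1

lemma sum_exp_boolSign {ι : Type*} [Fintype ι] [DecidableEq ι] (v : ι → ℝ) :
    ∑ σ : ι → Bool, Real.exp (∑ i, boolSign (σ i) * v i) = ∏ i, (2 * Real.cosh (v i)) := by
  have h : ∀ i, 2 * Real.cosh (v i) = ∑ b : Bool, Real.exp (boolSign b * v i) := by
    intro i
    rw [Real.cosh_eq]
    simp [boolSign]
    ring
  simp_rw [h, Finset.prod_univ_sum, Real.exp_sum, Fintype.piFinset_univ]

/-- Hoeffding's inequality in counting form, from `cosh x ≤ exp (x ^ 2 / 2)` and the optimal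
Chernoff parameter `u / V`. -/
lemma card_boolSign_gt_le {ι : Type*} [Fintype ι] [DecidableEq ι] (v : ι → ℝ) {V u : ℝ}
    (hV : 0 < V) (hv : ∑ i, v i ^ 2 ≤ V)
    (hu : 0 ≤ u) :
    (#{σ : ι → Bool | u < ∑ i, boolSign (σ i) * v i} : ℝ) ≤
      2 ^ Fintype.card ι * Real.exp (-(u ^ 2 / (2 * V))) := by
  set l := u / V
  have h1 : ∑ σ : ι → Bool, Real.exp (∑ i, boolSign (σ i) * (l * v i)) ≤
      2 ^ Fintype.card ι * Real.exp (l ^ 2 * V / 2) := by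
    rw [sum_exp_boolSign, prod_mul_distrib, prod_const, card_univ]
    gcongr
    calc ∏ i, Real.cosh (l * v i) ≤ ∏ i, Real.exp ((l * v i) ^ 2 / 2) :=
          prod_le_prod (fun i _ => (Real.cosh_pos _).le) fun i _ => Real.cosh_le_exp_half_sq _
      _ = Real.exp (l ^ 2 * (∑ i, v i ^ 2) / 2) := by
          rw [← Real.exp_sum, mul_sum, sum_div]
          simp_rw [mul_pow]
      _ ≤ _ := by gcongr
  have h2 : (#{σ : ι → Bool | u < ∑ i, boolSign (σ i) * v i} : ℝ) * Real.exp (l * u) ≤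
      ∑ σ : ι → Bool, Real.exp (∑ i, boolSign (σ i) * (l * v i)) := by
    rw [← nsmul_eq_mul, ← sum_const]
    refine (sum_le_sum fun σ hσ => ?_).trans
      (sum_le_sum_of_subset_of_nonneg (subset_univ _) fun _ _ _ => (Real.exp_pos _).le)
    simp only [mem_filter, mem_univ, true_and] at hσ
    have : ∑ i, boolSign (σ i) * (l * v i) = l * ∑ i, boolSign (σ i) * v i := by
      rw [mul_sum]
      exact sum_congr rfl fun i _ => by ring
    rw [this]
    gcongr
  have h3 : Real.exp (l ^ 2 * V / 2) = Real.exp (-(u ^ 2 / (2 * V))) * Real.exp (l * u) := by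
    rw [← Real.exp_add]
    congr 1
    simp only [l]
    field_simp
    ring
  refine le_of_mul_le_mul_right ((h2.trans h1).trans_eq ?_) (Real.exp_pos (l * u))
  rw [h3]
  ring

lemma card_abs_boolSign_gt_le {ι : Type*} [Fintype ι] [DecidableEq ι] (v : ι → ℝ) {V u : ℝ}
    (hV : 0 < V) (hv : ∑ i, v i ^ 2 ≤ V) (hu : 0 ≤ u) :
    (#{σ : ι → Bool | u < |∑ i, boolSign (σ i) * v i|} : ℝ) ≤
      2 ^ Fintype.card ι * (2 * Real.exp (-(u ^ 2 / (2 * V)))) := by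
  have h1 := card_boolSign_gt_le v hV hv hu
  have h2 := card_boolSign_gt_le (fun i => -v i) hV (by simpa using hv) hu
  have h3 : ({σ : ι → Bool | u < |∑ i, boolSign (σ i) * v i|} : Finset (ι → Bool)) ⊆
      ({σ : ι → Bool | u < ∑ i, boolSign (σ i) * v i} : Finset (ι → Bool)) ∪
      ({σ : ι → Bool | u < ∑ i, boolSign (σ i) * -v i} : Finset (ι → Bool)) := by
    intro σ
    simp only [mem_union, mem_filter, mem_univ, true_and, mul_neg, sum_neg_distrib]
    exact lt_abs.1
  have h4 : (#{σ : ι → Bool | u < |∑ i, boolSign (σ i) * v i|} : ℝ) ≤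
      #{σ : ι → Bool | u < ∑ i, boolSign (σ i) * v i} +
      #{σ : ι → Bool | u < ∑ i, boolSign (σ i) * -v i} := by
    exact_mod_cast (card_le_card h3).trans (card_union_le _ _)
  linarith

/-- The difference of the indicator functions of the two halves of a set of pairs. -/
noncomputable def pairDiff {ι : Type*} [DecidableEq ι] (a : Finset (ι × Bool)) (i : ι) : ℝ :=
  (if (i, true) ∈ a then 1 else 0) - (if (i, false) ∈ a then 1 else 0)

lemma sum_sq_pairDiff_sub_le {ι : Type*} [Fintype ι] [DecidableEq ι] (a b : Finset (ι × Bool)) :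
    ∑ i, (pairDiff a i - pairDiff b i) ^ 2 ≤ 2 * #(a ∆ b) := by
  have h : (#(a ∆ b) : ℝ) = ∑ i, ((if (i, true) ∈ a ∆ b then 1 else 0) +
      (if (i, false) ∈ a ∆ b then 1 else 0)) := by
    have : (#(a ∆ b) : ℝ) = ∑ p : ι × Bool, if p ∈ a ∆ b then 1 else 0 := by simp
    rw [this, Fintype.sum_prod_type]
    exact sum_congr rfl fun i _ => Fintype.sum_bool _
  rw [h, mul_sum]
  refine sum_le_sum fun i _ => ?_
  simp only [pairDiff, mem_symmDiff]
  split_ifs <;> first | tauto | norm_num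

lemma sum_range_succ_div_two_pow_le (J : ℕ) :
    ∑ j ∈ range J, ((j : ℝ) + 1) / 2 ^ j ≤ 4 := by
  have h : ∑ j ∈ range J, ((j : ℝ) + 1) / 2 ^ j = 4 - (2 * J + 4) / 2 ^ J := by
    induction J with
    | zero => simp
    | succ J ih =>
      rw [sum_range_succ, ih, pow_succ]
      push_cast
      field_simp
      ring
  rw [h]
  have : 0 ≤ (2 * (J : ℝ) + 4) / 2 ^ J := by positivity
  linarith

lemma sum_range_half_pow_le (J : ℕ) : ∑ j ∈ range J, ((1 : ℝ) / 2) ^ (j + 1) ≤ 1 := by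
  have h : ∑ j ∈ range J, ((1 : ℝ) / 2) ^ (j + 1) = 1 - (1 / 2) ^ J := by
    induction J with
    | zero => simp
    | succ J ih => rw [sum_range_succ, ih, pow_succ]; ring
  rw [h]
  have : (0 : ℝ) ≤ (1 / 2) ^ J := by positivity
  linarith

/-- The union bound at one level of the chaining argument. -/
lemma chaining_level_bound {D : ℕ} (hD1 : 1 ≤ D) {δ Q : ℝ} (hδ : 0 < δ) (hδ1 : δ ≤ 1)
    (hQ : D + Real.log (1 / δ) ≤ Q) (j : ℕ) :
    (2 * 16 ^ (D * (j + 1)) : ℝ) * (2 * 16 ^ (D * (j + 2))) *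
      (2 * Real.exp (-(16 * Q * ((j : ℝ) + 1) ^ 2))) ≤ δ * (1 / 2) ^ (j + 1) := by
  have hD : (1 : ℝ) ≤ D := by exact_mod_cast hD1
  have hL : 0 ≤ Real.log (1 / δ) := Real.log_nonneg (by rw [le_div_iff₀ hδ]; linarith)
  set L := Real.log (1 / δ) with hLdef
  have hexp : δ = Real.exp (-L) := by
    rw [hLdef, one_div, Real.log_inv, neg_neg, Real.exp_log hδ]
  have e1 : (2 : ℝ) ≤ Real.exp 1 := by
    have := Real.add_one_le_exp (1 : ℝ)
    linarith
  have e16 : ∀ k : ℕ, (16 : ℝ) ^ k ≤ Real.exp (4 * k) := by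
    intro k
    rw [mul_comm, Real.exp_nat_mul, show (4 : ℝ) = (4 : ℕ) * 1 by norm_num, Real.exp_nat_mul]
    gcongr
    calc (16 : ℝ) = 2 ^ 4 := by norm_num
      _ ≤ _ := by gcongr
  have e2 : Real.exp (-((j : ℝ) + 1)) ≤ (1 / 2) ^ (j + 1) := by
    rw [show -((j : ℝ) + 1) = ((j + 1 : ℕ) : ℝ) * (-1) by push_cast; ring, Real.exp_nat_mul,
      Real.exp_neg]
    gcongr
    rw [one_div]
    gcongr
  calc (2 * 16 ^ (D * (j + 1)) : ℝ) * (2 * 16 ^ (D * (j + 2))) *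
      (2 * Real.exp (-(16 * Q * ((j : ℝ) + 1) ^ 2)))
      ≤ (Real.exp 1 * Real.exp (4 * (D * (j + 1) : ℕ))) *
        (Real.exp 1 * Real.exp (4 * (D * (j + 2) : ℕ))) *
        (Real.exp 1 * Real.exp (-(16 * Q * ((j : ℝ) + 1) ^ 2))) := by
        gcongr <;> exact e16 _
    _ = Real.exp (3 + 4 * D * (2 * j + 3) - 16 * Q * ((j : ℝ) + 1) ^ 2) := by
        simp only [← Real.exp_add]
        push_cast
        congr 1
        ring
    _ ≤ Real.exp (-L + -((j : ℝ) + 1)) := by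
        gcongr
        have hj : (0 : ℝ) ≤ j := by positivity
        have h1 : (D + L) * ((j : ℝ) + 1) ^ 2 ≤ Q * ((j : ℝ) + 1) ^ 2 := by gcongr
        have h2 : 0 ≤ L * (j : ℝ) ^ 2 := by positivity
        have h3 : 0 ≤ L * (j : ℝ) := by positivity
        have h4 : 0 ≤ D * (j : ℝ) ^ 2 := by positivity
        have h5 : (j : ℝ) ≤ D * (j : ℝ) := le_mul_of_one_le_left hj hD
        nlinarith
    _ ≤ _ := by
        rw [Real.exp_add, ← hexp]
        gcongr

/-- Chaining bound for a Rademacher process indexed by a family of bounded VC dimension. -/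
theorem card_exists_boolSign_gt_le {ι : Type*} [Fintype ι] [DecidableEq ι] [Nonempty ι]
    (T : Finset (Finset (ι × Bool))) {D : ℕ} (hD1 : 1 ≤ D) (hD : T.vcDim ≤ D)
    {δ Q : ℝ} (hδ : 0 < δ) (hδ1 : δ ≤ 1) (hQ : D + Real.log (1 / δ) ≤ Q) :
    (#{σ : ι → Bool | ∃ a ∈ T, 64 * √(Fintype.card ι * Q) <
      |∑ i, boolSign (σ i) * pairDiff a i|} : ℝ) ≤ 2 ^ Fintype.card ι * δ := by
  classical
  set n := Fintype.card ι
  have hn : (0 : ℝ) < n := by exact_mod_cast Fintype.card_pos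
  have hL : 0 ≤ Real.log (1 / δ) := Real.log_nonneg (by rw [le_div_iff₀ hδ]; linarith)
  have hQ1 : 1 ≤ Q := by
    have : (1 : ℝ) ≤ D := by exact_mod_cast hD1
    linarith
  have hcardI : (Fintype.card (ι × Bool) : ℝ) = 2 * n := by
    rw [Fintype.card_prod, Fintype.card_bool]; push_cast; ring
  -- Nets at scale `4⁻ʲ` relative to the `2 * n` points. The net at level `0` is `{∅}`, where
  -- `pairDiff` vanishes, so the chain starts at zero.
  have hcov : ∀ j : ℕ, ∃ 𝒞 : Finset (Finset (ι × Bool)), (#𝒞 : ℝ) ≤ 2 * 16 ^ (D * (j + 1)) ∧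
      (∀ a ∈ T, ∃ c ∈ 𝒞, (#(a ∆ c) : ℝ) ≤ (1 / 4) ^ j * (2 * n)) ∧ (j = 0 → 𝒞 = {∅}) := by
    intro j
    rcases Nat.eq_zero_or_pos j with rfl | hj
    · refine ⟨{∅}, ?_, fun a _ => ⟨∅, by simp, ?_⟩, fun _ => rfl⟩
      · have : (1 : ℝ) ≤ 16 ^ (D * (0 + 1)) := one_le_pow₀ (by norm_num)
        simp only [card_singleton, Nat.cast_one]
        linarith
      · rw [pow_zero, one_mul, ← hcardI]
        exact_mod_cast card_le_univ _
    · obtain ⟨𝒞, h1, h2⟩ := exists_cover_of_vcDim_le hD (r := (1 / 4) ^ j) (by positivity)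
        (pow_le_one₀ (by norm_num) (by norm_num))
      refine ⟨𝒞, h1.trans_eq ?_, fun a ha => by rw [← hcardI]; exact h2 a ha, by omega⟩
      congr 1
      rw [div_eq_mul_inv, ← inv_pow, one_div, inv_inv, ← pow_succ', ← pow_mul,
        show (16 : ℝ) = 4 ^ 2 by norm_num, ← pow_mul]
      congr 1
      ring
  choose 𝒞 hcard hcover hzero using hcov
  -- At scale `J` the allowed symmetric difference has fewer than one element, so the chain ends at
  -- `a` itself.
  obtain ⟨J, hJ⟩ := exists_pow_lt_of_lt_one (show (0 : ℝ) < 1 / (2 * n) by positivity)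
    (show (1 / 4 : ℝ) < 1 by norm_num)
  rw [lt_div_iff₀ (by positivity)] at hJ
  -- The variance proxy at level `j` is `8 * n / 4 ^ j`, so this threshold gives the Hoeffding
  -- exponent `16 * Q * (j + 1) ^ 2`, which beats the net sizes. As `∑ (j + 1) / 2 ^ j ≤ 4`, the
  -- thresholds add up to at most `64 * √(n * Q)`.
  let u : ℕ → ℝ := fun j => 16 * √(n * Q) * (((j : ℝ) + 1) / 2 ^ j)
  have hu : ∀ j, 0 ≤ u j := fun j => by positivity
  let pairs : ℕ → Finset (Finset (ι × Bool) × Finset (ι × Bool)) := fun j =>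
    (𝒞 j ×ˢ 𝒞 (j + 1)).filter fun p => (#(p.1 ∆ p.2) : ℝ) ≤ 2 * (1 / 4) ^ j * (2 * n)
  let bad : Finset (ι × Bool) × Finset (ι × Bool) → ℕ → Finset (ι → Bool) := fun p j =>
    {σ : ι → Bool | u j < |∑ i, boolSign (σ i) * (pairDiff p.2 i - pairDiff p.1 i)|}
  have hbad : ∀ j, ∀ p ∈ pairs j, (#(bad p j) : ℝ) ≤
      2 ^ n * (2 * Real.exp (-(16 * Q * ((j : ℝ) + 1) ^ 2))) := by
    intro j p hp
    simp only [pairs, mem_filter] at hp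
    have hV : ∑ i, (pairDiff p.2 i - pairDiff p.1 i) ^ 2 ≤ 8 * n * (1 / 4) ^ j := by
      refine (sum_sq_pairDiff_sub_le _ _).trans ?_
      rw [symmDiff_comm]
      linarith [hp.2]
    have h := card_abs_boolSign_gt_le (fun i => pairDiff p.2 i - pairDiff p.1 i)
      (by positivity) hV (hu j)
    refine h.trans_eq ?_
    congr 4
    simp only [u]
    rw [mul_pow, mul_pow, Real.sq_sqrt (by positivity), div_pow, ← pow_mul, mul_comm j 2, pow_mul,
      one_div, inv_pow]
    norm_num
    field_simp
    ring
  have hsub : ({σ : ι → Bool | ∃ a ∈ T, 64 * √(n * Q) <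
      |∑ i, boolSign (σ i) * pairDiff a i|} : Finset (ι → Bool)) ⊆
      (range J).biUnion fun j => (pairs j).biUnion fun p => bad p j := by
    intro σ hσ
    simp only [mem_filter, mem_univ, true_and] at hσ
    obtain ⟨a, ha, hlt⟩ := hσ
    by_contra hnot
    simp only [mem_biUnion, mem_range, not_exists, not_and, bad, mem_filter, mem_univ, true_and,
      not_lt] at hnot
    have hπ : ∀ j, ∃ c ∈ 𝒞 j, (#(a ∆ c) : ℝ) ≤ (1 / 4) ^ j * (2 * n) := fun j => hcover j a ha
    choose π hπ1 hπ2 using hπ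
    have h0 : π 0 = ∅ := by
      have := hπ1 0
      rwa [hzero 0 rfl, mem_singleton] at this
    have hJa : π J = a := by
      have h1 := (hπ2 J).trans_lt hJ
      have h2 : #(a ∆ π J) = 0 := by
        have : #(a ∆ π J) < 1 := by exact_mod_cast h1
        omega
      rw [card_eq_zero] at h2
      exact (symmDiff_eq_bot.1 h2).symm
    have hstep : ∀ j ∈ range J,
        |∑ i, boolSign (σ i) * (pairDiff (π (j + 1)) i - pairDiff (π j) i)| ≤ u j := by
      intro j hj
      refine hnot j (mem_range.1 hj) (π j, π (j + 1)) ?_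
      simp only [pairs, mem_filter, mem_product]
      refine ⟨⟨hπ1 j, hπ1 (j + 1)⟩, ?_⟩
      have h1 : (#(π j ∆ π (j + 1)) : ℝ) ≤ #(a ∆ π j) + #(a ∆ π (j + 1)) := by
        have h2 := symmDiff_triangle (π j) a (π (j + 1))
        rw [symmDiff_comm (π j) a] at h2
        exact_mod_cast (card_le_card h2).trans (card_union_le _ _)
      have h2 := hπ2 j
      have h3 := hπ2 (j + 1)
      have h4 : ((1 : ℝ) / 4) ^ (j + 1) * (2 * n) ≤ (1 / 4) ^ j * (2 * n) := by
        gcongr ?_ * _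
        exact pow_le_pow_of_le_one (by norm_num) (by norm_num) (Nat.le_succ j)
      linarith
    have htel : ∑ i, boolSign (σ i) * pairDiff a i =
        ∑ j ∈ range J, ∑ i, boolSign (σ i) * (pairDiff (π (j + 1)) i - pairDiff (π j) i) := by
      rw [sum_comm]
      refine sum_congr rfl fun i _ => ?_
      rw [← mul_sum, sum_range_sub (fun j => pairDiff (π j) i), hJa, h0]
      simp [pairDiff]
    have : |∑ i, boolSign (σ i) * pairDiff a i| ≤ 64 * √(n * Q) := by
      rw [htel]
      calc _ ≤ ∑ j ∈ range J, u j := (abs_sum_le_sum_abs _ _).trans (sum_le_sum hstep)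
        _ = 16 * √(n * Q) * ∑ j ∈ range J, ((j : ℝ) + 1) / 2 ^ j := by rw [mul_sum]
        _ ≤ 16 * √(n * Q) * 4 := by gcongr; exact sum_range_succ_div_two_pow_le J
        _ = _ := by ring
    linarith
  calc (#{σ : ι → Bool | ∃ a ∈ T, 64 * √(n * Q) <
      |∑ i, boolSign (σ i) * pairDiff a i|} : ℝ)
      ≤ ∑ j ∈ range J, ∑ p ∈ pairs j, (#(bad p j) : ℝ) := by
        exact_mod_cast (card_le_card hsub).trans
          (card_biUnion_le.trans (sum_le_sum fun j _ => card_biUnion_le))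
    _ ≤ ∑ j ∈ range J, 2 ^ n * (δ * (1 / 2) ^ (j + 1)) := by
        refine sum_le_sum fun j _ => ?_
        have hp : (#(pairs j) : ℝ) ≤ (2 * 16 ^ (D * (j + 1))) * (2 * 16 ^ (D * (j + 2))) := by
          have h1 : (#(pairs j) : ℝ) ≤ #(𝒞 j) * #(𝒞 (j + 1)) := by
            exact_mod_cast (card_filter_le _ _).trans_eq (card_product _ _)
          exact h1.trans (mul_le_mul (hcard j) (hcard (j + 1)) (by positivity) (by positivity))
        calc ∑ p ∈ pairs j, (#(bad p j) : ℝ)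
            ≤ #(pairs j) * (2 ^ n * (2 * Real.exp (-(16 * Q * ((j : ℝ) + 1) ^ 2)))) := by
              rw [← nsmul_eq_mul, ← sum_const]
              exact sum_le_sum (hbad j)
          _ ≤ ((2 * 16 ^ (D * (j + 1))) * (2 * 16 ^ (D * (j + 2)))) *
              (2 ^ n * (2 * Real.exp (-(16 * Q * ((j : ℝ) + 1) ^ 2)))) := by gcongr
          _ = 2 ^ n * ((2 * 16 ^ (D * (j + 1))) * (2 * 16 ^ (D * (j + 2))) *
              (2 * Real.exp (-(16 * Q * ((j : ℝ) + 1) ^ 2)))) := by ring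
          _ ≤ _ := by 
              exact mul_le_mul_of_nonneg_left (chaining_level_bound hD1 hδ hδ1 hQ j) (by positivity)
    _ = 2 ^ n * δ * ∑ j ∈ range J, ((1 : ℝ) / 2) ^ (j + 1) := by
        rw [mul_sum]
        exact sum_congr rfl fun j _ => by ring
    _ ≤ 2 ^ n * δ * 1 := by gcongr; exact sum_range_half_pow_le J
    _ = _ := mul_one _

end DistLearn

/-! ### Uniform convergence of empirical frequencies over VC classes. -/

namespace DistLearn

open Finset

/-- The family of sets `A k` shatters no set of more than `D` points. -/
def VCDimLE {X κ : Type*} (A : κ → Set X) (D : ℕ) : Prop :=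
  ∀ t : Finset X, (∀ u ⊆ t, ∃ k, ∀ x ∈ t, x ∈ A k ↔ x ∈ u) → #t ≤ D

open Classical in
/-- The index sets cut out by a family of sets on a finite family of points. -/
noncomputable def traceFamily {X κ I : Type*} [Fintype I] (A : κ → Set X) (z : I → X) :
    Finset (Finset I) :=
  {s | ∃ k, ∀ i, i ∈ s ↔ z i ∈ A k}

lemma VCDimLE.vcDim_traceFamily_le {X κ I : Type*} [Fintype I] [DecidableEq I] {A : κ → Set X}
    {D : ℕ} (hA : VCDimLE A D) (z : I → X) : (traceFamily A z).vcDim ≤ D := by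
  classical
  refine Finset.sup_le fun t ht => ?_
  rw [mem_shatterer] at ht
  have key : ∀ u ⊆ t, ∃ k, ∀ i ∈ t, z i ∈ A k ↔ i ∈ u := by
    intro u hu
    obtain ⟨b, hb, hbt⟩ := ht hu
    obtain ⟨k, hk⟩ := (mem_filter.1 hb).2
    refine ⟨k, fun i hi => ?_⟩
    rw [← hbt, ← hk]
    simp [hi]
  have hinj : Set.InjOn z t := by
    intro i hi j hj hij
    obtain ⟨a, h⟩ := key {i} (by simpa using hi)
    have h1 := (h i hi).2 (by simp)
    rw [hij] at h1
    exact (mem_singleton.1 ((h j hj).1 h1)).symm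
  rw [← card_image_of_injOn hinj]
  refine hA _ fun u hu => ?_
  obtain ⟨a, h⟩ := key (t.filter fun i => z i ∈ u) (filter_subset _ _)
  refine ⟨a, fun x hx => ?_⟩
  obtain ⟨i, hi, rfl⟩ := mem_image.1 hx
  rw [h i hi]
  simp [hi]

/-- Positivity sets of a `D`-dimensional space of functions have VC dimension at most `D`. -/
lemma vcDimLE_setOf_pos {X κ J : Type*} [Fintype J] (φ : X → J → ℝ) (a : κ → J → ℝ) :
    VCDimLE (fun k => {x | 0 < ∑ j, a k j * φ x j}) (Fintype.card J) := by
  classical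
  intro t ht
  by_contra! hcard
  have hdep : ¬ LinearIndependent ℝ fun x : t => φ x := by
    intro h
    have := h.fintype_card_le_finrank
    rw [Fintype.card_coe, Module.finrank_fintype_fun_eq_card] at this
    omega
  obtain ⟨w, hw, x₀, hx₀⟩ := Fintype.not_linearIndependent_iff.1 hdep
  -- For a linear relation `w`, shattering yields a function positive exactly where `w` is. Pairing
  -- it with `w` gives zero, yet all terms are nonnegative and one is positive if some `w x₁ > 0`.
  -- Applying this to `w` and `-w` forces `w = 0`.
  have key : ∀ w : t → ℝ, ∑ x, w x • φ x = 0 → ∀ x, w x ≤ 0 := by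
    intro w hw x₁
    by_contra! hx₁
    obtain ⟨k, hk⟩ := ht (((univ : Finset t).filter fun x => 0 < w x).map
      (Function.Embedding.subtype _))
      (by
        intro x hx
        obtain ⟨y, -, rfl⟩ := mem_map.1 hx
        exact y.2)
    have hk' : ∀ x : t, 0 < ∑ j, a k j * φ x j ↔ 0 < w x := by
      intro x
      have := hk x x.2
      simpa using this
    have hzero : ∑ x : t, w x * ∑ j, a k j * φ x j = 0 := by
      calc ∑ x : t, w x * ∑ j, a k j * φ x j
          = ∑ j, a k j * (∑ x : t, w x • φ x) j := by
            simp_rw [mul_sum, Finset.sum_apply, Pi.smul_apply, smul_eq_mul, mul_sum]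
            rw [sum_comm]
            exact sum_congr rfl fun j _ => sum_congr rfl fun x _ => by ring
        _ = 0 := by rw [hw]; simp
    have hpos : 0 < ∑ x : t, w x * ∑ j, a k j * φ x j := by
      refine sum_pos' (fun x _ => ?_) ⟨x₁, mem_univ _, mul_pos hx₁ ((hk' x₁).2 hx₁)⟩
      rcases lt_or_ge 0 (w x) with h | h
      · exact (mul_pos h ((hk' x).2 h)).le
      · exact mul_nonneg_of_nonpos_of_nonpos h (not_lt.1 fun h' => not_lt.2 h ((hk' x).1 h'))
    exact hpos.ne' hzero
  have h1 := key w hw x₀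
  have h2 := key (fun x => -w x) (by simp_rw [neg_smul, sum_neg_distrib, hw, neg_zero]) x₀
  exact hx₀ (le_antisymm h1 (by linarith))

/-- The empirical frequency of a set in a sample. -/
noncomputable def empFreq {X : Type*} {n : ℕ} (S : Fin n → X) (A : Set X) : ℝ :=
  (∑ i, A.indicator 1 (S i)) / n

variable {X : Type*} [MeasurableSpace X]

lemma measurable_empFreq {n : ℕ} {A : Set X} (hA : MeasurableSet A) :
    Measurable fun S : Fin n → X => empFreq S A := by
  unfold empFreq
  have : Measurable (A.indicator (1 : X → ℝ)) := measurable_one.indicator hA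
  fun_prop

/-- Chebyshev, with variance at most `1 / 4` per sample point. Probability `1 / 2` suffices for the
ghost sample. -/
lemma measure_empFreq_sub_ge_le (g : Measure X) [IsProbabilityMeasure g] {n : ℕ} {A : Set X}
    (hA : MeasurableSet A) {ε : ℝ} (hε : 0 < ε) (hn : 2 ≤ n * ε ^ 2) :
    (Measure.pi fun _ : Fin n => g) {S | ε / 2 ≤ |empFreq S A - g.real A|} ≤ 1 / 2 := by
  have hn0 : (0 : ℝ) < n := by
    by_contra! h
    have : (n : ℝ) * ε ^ 2 ≤ 0 := mul_nonpos_of_nonpos_of_nonneg h (by positivity)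
    linarith
  set f : X → ℝ := A.indicator 1
  have hf : Measurable f := measurable_one.indicator hA
  have hf01 : ∀ x, f x ∈ Set.Icc (0 : ℝ) 1 := by
    intro x
    by_cases h : x ∈ A <;> simp [f, h]
  have hf2 : MemLp f 2 g := MemLp.of_bound hf.aestronglyMeasurable 1 <| .of_forall fun x => by
    rw [Real.norm_of_nonneg (hf01 x).1]; exact (hf01 x).2
  set F : (Fin n → X) → ℝ := ∑ i, fun S => f (S i)
  have hFm : MemLp F 2 (Measure.pi fun _ : Fin n => g) :=
    memLp_finsetSum' _ fun i _ => hf2.comp_measurePreserving (measurePreserving_eval _ i)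
  have hvar : Var[F; Measure.pi fun _ : Fin n => g] ≤ n / 4 := by
    rw [variance_sum_pi fun _ => hf2]
    calc ∑ i : Fin n, Var[f; g] ≤ ∑ i : Fin n, ((1 - 0) / 2 : ℝ) ^ 2 :=
          sum_le_sum fun i _ => variance_le_sq_of_bounded (.of_forall hf01) hf.aemeasurable
      _ = _ := by simp; ring
  have hmean : (Measure.pi fun _ : Fin n => g)[F] = n * g.real A := by
    simp only [F, Finset.sum_apply]
    rw [integral_finsetSum]
    · have : ∀ i : Fin n, ∫ S, f (S i) ∂(Measure.pi fun _ : Fin n => g) = g.real A := by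
        intro i
        rw [integral_comp_eval hf.aestronglyMeasurable]
        exact integral_indicator_one hA
      simp [this]
    · intro i _
      exact (hf2.comp_measurePreserving (measurePreserving_eval _ i)).integrable (by norm_num)
  have hcheb := meas_ge_le_variance_div_sq hFm (c := n * ε / 2) (by positivity)
  rw [hmean] at hcheb
  have hset : {S : Fin n → X | ε / 2 ≤ |empFreq S A - g.real A|} =
      {S | n * ε / 2 ≤ |F S - n * g.real A|} := by
    ext S
    have : F S - n * g.real A = n * (empFreq S A - g.real A) := by
      simp only [empFreq, F, f, Finset.sum_apply]
      field_simp
    rw [Set.mem_ofPred_eq, Set.mem_ofPred_eq, this, abs_mul, abs_of_pos hn0, mul_div_assoc,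
      mul_le_mul_iff_right₀ hn0]
  rw [hset]
  refine hcheb.trans ?_
  rw [show (1 / 2 : ENNReal) = ENNReal.ofReal (1 / 2) by
    rw [ENNReal.ofReal_div_of_pos (by norm_num)]; simp]
  refine ENNReal.ofReal_le_ofReal ?_
  rw [div_le_iff₀ (by positivity)]
  nlinarith

lemma measurableSet_exists_lt {Y : Type*} [MeasurableSpace Y] {f : ℕ → Y → ℝ}
    (hf : ∀ k, Measurable (f k)) (c : ℝ) : MeasurableSet {y | ∃ k, c < f k y} := by
  rw [Set.ofPred_exists]
  exact MeasurableSet.iUnion fun k => measurableSet_lt measurable_const (hf k)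

/-- Symmetrization by a ghost sample. -/
lemma measure_exists_empFreq_sub_gt_le (g : Measure X) [IsProbabilityMeasure g] {n : ℕ}
    {A : ℕ → Set X} (hA : ∀ k, MeasurableSet (A k)) {ε : ℝ} (hε : 0 < ε) (hn : 2 ≤ n * ε ^ 2) :
    (Measure.pi fun _ : Fin n => g) {S | ∃ k, ε < |empFreq S (A k) - g.real (A k)|} ≤
      2 * ((Measure.pi fun _ : Fin n => g).prod (Measure.pi fun _ : Fin n => g))
        {p | ∃ k, ε / 2 < |empFreq p.1 (A k) - empFreq p.2 (A k)|} := by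
  set P := Measure.pi fun _ : Fin n => g
  set E := {S : Fin n → X | ∃ k, ε < |empFreq S (A k) - g.real (A k)|}
  have hE : MeasurableSet E := measurableSet_exists_lt
    (fun k => ((measurable_empFreq (hA k)).sub_const _).abs) _
  have hE2 : MeasurableSet {p : (Fin n → X) × (Fin n → X) |
      ∃ k, ε / 2 < |empFreq p.1 (A k) - empFreq p.2 (A k)|} := measurableSet_exists_lt
    (fun k => (((measurable_empFreq (hA k)).comp measurable_fst).sub
      ((measurable_empFreq (hA k)).comp measurable_snd)).abs) _
  rw [Measure.prod_apply hE2]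
  have hhalf : ∀ S ∈ E, (1 / 2 : ENNReal) ≤ P (Prod.mk S ⁻¹' {p : (Fin n → X) × (Fin n → X) |
      ∃ k, ε / 2 < |empFreq p.1 (A k) - empFreq p.2 (A k)|}) := by
    rintro S ⟨k, hk⟩
    set B := {S' : Fin n → X | ε / 2 ≤ |empFreq S' (A k) - g.real (A k)|}
    have hB : MeasurableSet B := measurableSet_le measurable_const
      ((measurable_empFreq (hA k)).sub_const _).abs
    have h1 : P B ≤ 1 / 2 := measure_empFreq_sub_ge_le g (hA k) hε hn
    have h2 : (1 / 2 : ENNReal) ≤ P Bᶜ := by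
      rw [prob_compl_eq_one_sub hB]
      calc (1 / 2 : ENNReal) = 1 - 1 / 2 := by simp
        _ ≤ _ := tsub_le_tsub_left h1 _
    refine h2.trans (measure_mono fun S' hS' => ⟨k, ?_⟩)
    simp only [B, Set.mem_compl_iff, Set.mem_ofPred_eq, not_le] at hS'
    have := abs_sub_le (empFreq S (A k)) (empFreq S' (A k)) (g.real (A k))
    show ε / 2 < |empFreq S (A k) - empFreq S' (A k)|
    linarith
  calc P E = 2 * (1 / 2 * P E) := by
        rw [← mul_assoc, one_div, ENNReal.mul_inv_cancel (by norm_num) (by norm_num), one_mul]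
    _ = 2 * ∫⁻ _ in E, 1 / 2 ∂P := by rw [setLIntegral_const]
    _ ≤ 2 * ∫⁻ S in E, P (Prod.mk S ⁻¹' {p : (Fin n → X) × (Fin n → X) |
          ∃ k, ε / 2 < |empFreq p.1 (A k) - empFreq p.2 (A k)|}) ∂P := by
        gcongr 2 * ?_
        exact setLIntegral_mono' hE hhalf
    _ ≤ _ := by gcongr 2 * ?_; exact setLIntegral_le_lintegral _ _

/-- Swap the entries of those pairs whose sign is negative. -/
def swapPairs {n : ℕ} (σ : Fin n → Bool) (w : Fin n → X × X) (i : Fin n) : X × X :=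
  if σ i then w i else (w i).swap

lemma measurePreserving_swapPairs (g : Measure X) [IsProbabilityMeasure g] {n : ℕ}
    (σ : Fin n → Bool) :
    MeasurePreserving (swapPairs σ) (Measure.pi fun _ : Fin n => g.prod g)
      (Measure.pi fun _ : Fin n => g.prod g) := by
  refine measurePreserving_pi (f := fun i (p : X × X) => if σ i then p else p.swap) _ _ fun i => ?_
  cases h : σ i
  · simpa using Measure.measurePreserving_swap
  · simp only [if_true]
    exact MeasurePreserving.id _

/-- Swapping entries within pairs preserves the product law, so the probability is an average over
the `2 ^ n` swap patterns. For fixed pairs, chaining on the `2 * n` pooled points bounds the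
proportion of bad patterns by `δ`. -/
lemma measure_prod_exists_empFreq_sub_gt_le (g : Measure X) [IsProbabilityMeasure g] {n : ℕ}
    (hn : 0 < n) {A : ℕ → Set X} (hA : ∀ k, MeasurableSet (A k)) {D : ℕ} (hD1 : 1 ≤ D)
    (hD : VCDimLE A D) {ε δ Q : ℝ} (hδ : 0 < δ) (hδ1 : δ ≤ 1) (hQ : D + Real.log (1 / δ) ≤ Q)
    (hε : 64 * √(n * Q) ≤ n * ε) :
    ((Measure.pi fun _ : Fin n => g).prod (Measure.pi fun _ : Fin n => g))
        {p | ∃ k, ε < |empFreq p.1 (A k) - empFreq p.2 (A k)|} ≤ ENNReal.ofReal δ := by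
  classical
  have hn0 : (0 : ℝ) < n := by exact_mod_cast hn
  have : Nonempty (Fin n) := ⟨⟨0, hn⟩⟩
  set P := Measure.pi fun _ : Fin n => g.prod g
  set E : Set (Fin n → X × X) := {w | ∃ k, ε < |empFreq (fun i => (w i).1) (A k) -
    empFreq (fun i => (w i).2) (A k)|}
  have hE : MeasurableSet E := measurableSet_exists_lt
    (fun k => (((measurable_empFreq (hA k)).comp (by fun_prop)).sub
      ((measurable_empFreq (hA k)).comp (by fun_prop))).abs) _
  have hmp := measurePreserving_arrowProdEquivProdArrow X X (Fin n) (fun _ => g) (fun _ => g)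
  rw [← hmp.measure_preimage_equiv]
  change P E ≤ _
  have hcount : ∀ w, (∑ σ : Fin n → Bool, (swapPairs σ ⁻¹' E).indicator (1 : (Fin n → X × X) → ENNReal) w) ≤
      ENNReal.ofReal (2 ^ n * δ) := by
    intro w
    have h1 : ∑ σ : Fin n → Bool, (swapPairs σ ⁻¹' E).indicator (1 : (Fin n → X × X) → ENNReal) w =
        (#{σ : Fin n → Bool | swapPairs σ w ∈ E} : ℕ) := by
      simp [Set.indicator_apply]
    rw [h1, ← ENNReal.ofReal_natCast]
    refine ENNReal.ofReal_le_ofReal ?_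
    let z : Fin n × Bool → X := fun p => if p.2 then (w p.1).1 else (w p.1).2
    have h2 := card_exists_boolSign_gt_le (traceFamily A z) hD1 (hD.vcDim_traceFamily_le z)
      hδ hδ1 hQ
    rw [Fintype.card_fin] at h2
    refine le_trans ?_ h2
    refine Nat.cast_le.2 (card_le_card fun σ hσ => ?_)
    simp only [mem_filter, mem_univ, true_and, E, Set.mem_ofPred_eq] at hσ ⊢
    obtain ⟨k, hk⟩ := hσ
    refine ⟨univ.filter fun p => z p ∈ A k, mem_filter.2 ⟨mem_univ _, k, by simp⟩, ?_⟩
    refine hε.trans_lt ?_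
    have h3 : ∑ i, boolSign (σ i) * pairDiff (univ.filter fun p => z p ∈ A k) i =
        n * (empFreq (fun i => (swapPairs σ w i).1) (A k) -
          empFreq (fun i => (swapPairs σ w i).2) (A k)) := by
      simp only [empFreq]
      rw [← sub_div, mul_div_cancel₀ _ hn0.ne', ← sum_sub_distrib]
      refine sum_congr rfl fun i _ => ?_
      cases h : σ i <;> simp [boolSign, pairDiff, swapPairs, z, h, Set.indicator_apply]
    rw [h3, abs_mul, abs_of_pos hn0]
    gcongr
  have hsum : ((2 ^ n : ℕ) : ENNReal) * P E ≤ ((2 ^ n : ℕ) : ENNReal) * ENNReal.ofReal δ := by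
    calc ((2 ^ n : ℕ) : ENNReal) * P E = ∑ σ : Fin n → Bool, P (swapPairs σ ⁻¹' E) := by
          rw [sum_congr rfl fun σ _ =>
            (measurePreserving_swapPairs g σ).measure_preimage hE.nullMeasurableSet]
          simp [P]
      _ = ∑ σ : Fin n → Bool, ∫⁻ w, (swapPairs σ ⁻¹' E).indicator 1 w ∂P := by
          refine sum_congr rfl fun σ _ => ?_
          rw [lintegral_indicator_one ((measurePreserving_swapPairs g σ).measurable hE)]
      _ = ∫⁻ w, ∑ σ : Fin n → Bool, (swapPairs σ ⁻¹' E).indicator 1 w ∂P := by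
          rw [lintegral_finsetSum]
          exact fun σ _ => measurable_one.indicator
            ((measurePreserving_swapPairs g σ).measurable hE)
      _ ≤ ∫⁻ _, ENNReal.ofReal (2 ^ n * δ) ∂P := lintegral_mono hcount
      _ = _ := by
          rw [lintegral_const, measure_univ, mul_one, ENNReal.ofReal_mul (by positivity)]
          congr 1
          rw [← ENNReal.ofReal_natCast]
          norm_num
  exact (ENNReal.mul_le_mul_iff_right (by positivity) (ENNReal.natCast_ne_top _)).1 hsum

/-- Uniform convergence of the empirical frequencies over a family of bounded VC dimension, without
a logarithmic factor in the sample size. -/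
theorem measure_exists_empFreq_sub_gt_le_of_vcDimLE (g : Measure X) [IsProbabilityMeasure g] {n : ℕ}
    {A : ℕ → Set X} (hA : ∀ k, MeasurableSet (A k)) {D : ℕ} (hD1 : 1 ≤ D)
    (hD : VCDimLE A D) {ε δ : ℝ} (hε : 0 < ε) (hδ : 0 < δ) (hδ1 : δ ≤ 1)
    (hn : 128 ^ 2 * (D + 1 + Real.log (1 / δ)) ≤ n * ε ^ 2) :
    (Measure.pi fun _ : Fin n => g) {S | ∃ k, ε < |empFreq S (A k) - g.real (A k)|} ≤
      ENNReal.ofReal δ := by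
  have hD' : (1 : ℝ) ≤ D := by exact_mod_cast hD1
  have hL : 0 ≤ Real.log (1 / δ) := Real.log_nonneg (by rw [le_div_iff₀ hδ]; linarith)
  have hn0 : 0 < n := by
    rcases Nat.eq_zero_or_pos n with rfl | h
    · rw [Nat.cast_zero, zero_mul] at hn
      linarith
    · exact h
  have hn0' : (0 : ℝ) < n := by exact_mod_cast hn0
  have h1 := measure_exists_empFreq_sub_gt_le g hA hε (by linarith : (2 : ℝ) ≤ n * ε ^ 2)
  -- Symmetrization costs a factor `2` in both `ε` and `δ`; the `+ 1` in `Q` absorbs the resulting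
  -- `log 2`.
  have h2 := measure_prod_exists_empFreq_sub_gt_le g hn0 hA hD1 hD (ε := ε / 2) (δ := δ / 2)
    (Q := D + 1 + Real.log (1 / δ)) (by positivity) (by linarith)
    (by
      rw [one_div_div, show 2 / δ = 2 * (1 / δ) by ring, Real.log_mul (by norm_num) (by positivity)]
      have := Real.log_two_lt_d9
      linarith)
    (by
      have h3 : √(n * (D + 1 + Real.log (1 / δ))) ≤ n * ε / 128 := by
        refine Real.sqrt_le_iff.2 ⟨by positivity, ?_⟩
        rw [div_pow, le_div_iff₀ (by norm_num), mul_pow]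
        nlinarith
      linarith)
  calc _ ≤ _ := h1
    _ ≤ 2 * ENNReal.ofReal (δ / 2) := by gcongr
    _ = ENNReal.ofReal δ := by
      rw [show (2 : ENNReal) = ENNReal.ofReal 2 by simp, ← ENNReal.ofReal_mul (by norm_num)]
      congr 1
      ring

end DistLearn

/-! ### Total variation, densities and the minimum distance estimate. -/

namespace DistLearn

section TotalVariation

variable {X : Type*} [MeasurableSpace X] (p q r : ProbabilityMeasure X)

lemma abs_real_sub_real_le_one (B : Set X) :
    |(p : Measure X).real B - (q : Measure X).real B| ≤ 1 := by
  have h1 : (p : Measure X).real B ≤ 1 := measureReal_le_one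
  have h2 : (q : Measure X).real B ≤ 1 := measureReal_le_one
  have h3 : 0 ≤ (p : Measure X).real B := measureReal_nonneg
  have h4 : 0 ≤ (q : Measure X).real B := measureReal_nonneg
  rw [abs_le]
  constructor <;> linarith

lemma abs_real_sub_real_le_tvDist {B : Set X} (hB : MeasurableSet B) :
    |(p : Measure X).real B - (q : Measure X).real B| ≤ tvDist p q := by
  refine le_ciSup (f := fun B : {B : Set X // MeasurableSet B} =>
    |(p : Measure X).real B.1 - (q : Measure X).real B.1|) ⟨1, ?_⟩ ⟨B, hB⟩
  rintro _ ⟨B, rfl⟩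
  exact abs_real_sub_real_le_one p q _

variable {p q} in
lemma tvDist_le {c : ℝ}
    (h : ∀ B, MeasurableSet B → |(p : Measure X).real B - (q : Measure X).real B| ≤ c) :
    tvDist p q ≤ c := by
  have : Nonempty {B : Set X // MeasurableSet B} := ⟨⟨∅, MeasurableSet.empty⟩⟩
  exact ciSup_le fun B => h B.1 B.2

lemma tvDist_nonneg : 0 ≤ tvDist p q :=
  (abs_nonneg _).trans (abs_real_sub_real_le_tvDist p q MeasurableSet.empty)

lemma tvDist_le_one : tvDist p q ≤ 1 := tvDist_le fun B _ => abs_real_sub_real_le_one p q B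

lemma tvDist_triangle : tvDist p r ≤ tvDist p q + tvDist q r :=
  tvDist_le fun _ hB => (abs_sub_le _ _ _).trans
    (add_le_add (abs_real_sub_real_le_tvDist p q hB) (abs_real_sub_real_le_tvDist q r hB))

lemma opt_nonneg (F : Set (ProbabilityMeasure X)) : 0 ≤ opt F p :=
  Real.iInf_nonneg fun _ => mul_nonneg two_pos.le (tvDist_nonneg _ _)

lemma exists_l1Dist_lt {F : Set (ProbabilityMeasure X)} (hF : F.Nonempty) {η : ℝ} (hη : 0 < η) :
    ∃ f ∈ F, l1Dist f p < opt F p + η := by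
  have := hF.to_subtype
  obtain ⟨f, hf⟩ := exists_lt_of_ciInf_lt (show opt F p < opt F p + η by linarith)
  exact ⟨f.1, f.2, hf⟩

/-- For such `ε` no sample is needed, which matters because the claimed bound on `m` may be below
`1`. -/
lemma isApproximation_of_two_le (F : Set (ProbabilityMeasure X)) {ε C : ℝ} (hC : 0 ≤ C)
    (hε : 2 ≤ ε) : IsApproximation F ε C p q := by
  have h1 := tvDist_le_one p q
  have h2 := mul_nonneg hC (opt_nonneg q F)
  unfold IsApproximation l1Dist
  linarith

end TotalVariation

lemma empFreq_mem_Icc {X : Type*} {n : ℕ} (S : Fin n → X) (A : Set X) :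
    empFreq S A ∈ Set.Icc (0 : ℝ) 1 := by
  have h : ∀ x, A.indicator (1 : X → ℝ) x ∈ Set.Icc (0 : ℝ) 1 := by
    intro x
    by_cases h : x ∈ A <;> simp [h]
  refine ⟨div_nonneg (Finset.sum_nonneg fun i _ => (h _).1) (Nat.cast_nonneg n),
    div_le_one_of_le₀ ?_ (Nat.cast_nonneg n)⟩
  simpa using Finset.sum_le_sum fun (i : Fin n) (_ : i ∈ Finset.univ) => (h (S i)).2

variable {X : Type*} [MeasurableSpace X]

/-- `ρ` is a density of `p` with respect to `ν`. -/
structure IsDensity (ν : Measure X) (p : ProbabilityMeasure X) (ρ : X → ℝ) : Prop where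
  measurable : Measurable ρ
  nonneg : ∀ x, 0 ≤ ρ x
  eq_withDensity : (p : Measure X) = ν.withDensity fun x => ENNReal.ofReal (ρ x)

namespace IsDensity

variable {ν : Measure X} {p q : ProbabilityMeasure X} {ρ τ : X → ℝ}

lemma measure_apply (h : IsDensity ν p ρ) {B : Set X} (hB : MeasurableSet B) :
    (p : Measure X) B = ∫⁻ x in B, ENNReal.ofReal (ρ x) ∂ν := by
  rw [h.eq_withDensity, withDensity_apply _ hB]

lemma integrable (h : IsDensity ν p ρ) : Integrable ρ ν := by
  refine ⟨h.measurable.aestronglyMeasurable, ?_⟩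
  rw [hasFiniteIntegral_iff_ofReal (.of_forall h.nonneg), ← setLIntegral_univ,
    ← h.measure_apply MeasurableSet.univ]
  simp

lemma real_apply (h : IsDensity ν p ρ) {B : Set X} (hB : MeasurableSet B) :
    (p : Measure X).real B = ∫ x in B, ρ x ∂ν := by
  rw [Measure.real, h.measure_apply hB,
    integral_eq_lintegral_of_nonneg_ae (.of_forall h.nonneg) h.measurable.aestronglyMeasurable]

lemma tvDist_le_dist (hp : IsDensity ν p ρ) (hq : IsDensity ν q τ) :
    tvDist p q ≤ dist (hp.integrable.toL1 ρ) (hq.integrable.toL1 τ) := by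
  rw [dist_eq_norm, ← Integrable.toL1_sub, L1.norm_of_fun_eq_integral_norm]
  refine tvDist_le fun B hB => ?_
  rw [hp.real_apply hB, hq.real_apply hB,
    ← integral_sub hp.integrable.integrableOn hq.integrable.integrableOn]
  calc |∫ x in B, ρ x - τ x ∂ν| ≤ ∫ x in B, ‖ρ x - τ x‖ ∂ν :=
        (Real.norm_eq_abs _).symm.trans_le (norm_integral_le_integral_norm _)
    _ ≤ ∫ x, ‖ρ x - τ x‖ ∂ν := setIntegral_le_integral (hp.integrable.sub hq.integrable).norm
        (.of_forall fun _ => norm_nonneg _)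

lemma real_le_real (hp : IsDensity ν p ρ) (hq : IsDensity ν q τ) {B : Set X}
    (hB : MeasurableSet B) (h : ∀ x ∈ B, ρ x ≤ τ x) :
    (p : Measure X).real B ≤ (q : Measure X).real B := by
  rw [hp.real_apply hB, hq.real_apply hB]
  exact setIntegral_mono_on hp.integrable.integrableOn hq.integrable.integrableOn hB h

/-- The total variation distance is attained on the set where one density exceeds the other. -/
lemma tvDist_le_of_setOf_lt (hp : IsDensity ν p ρ) (hq : IsDensity ν q τ) :
    tvDist p q ≤ |(p : Measure X).real {x | τ x < ρ x} - (q : Measure X).real {x | τ x < ρ x}| := by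
  set A := {x | τ x < ρ x}
  have hA : MeasurableSet A := measurableSet_lt hq.measurable hp.measurable
  have key : ∀ B, MeasurableSet B → (p : Measure X).real B - (q : Measure X).real B ≤
      (p : Measure X).real A - (q : Measure X).real A := by
    intro B hB
    have h1 := hp.real_le_real hq (hB.diff hA) fun x hx => not_lt.1 hx.2
    have h2 := hq.real_le_real hp (hA.diff hB) fun x hx => le_of_lt hx.1
    have h3 := measureReal_inter_add_sdiff (μ := (p : Measure X)) (s := B) hA
    have h4 := measureReal_inter_add_sdiff (μ := (q : Measure X)) (s := B) hA
    have h5 := measureReal_inter_add_sdiff (μ := (p : Measure X)) (s := A) hB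
    have h6 := measureReal_inter_add_sdiff (μ := (q : Measure X)) (s := A) hB
    rw [Set.inter_comm] at h5 h6
    linarith
  refine tvDist_le fun B hB => ?_
  refine le_trans ?_ (le_abs_self _)
  rw [abs_le]
  refine ⟨?_, key B hB⟩
  -- Complementing reverses the sign of the difference of two probabilities.
  have h := key Bᶜ hB.compl
  rw [probReal_compl_eq_one_sub hB, probReal_compl_eq_one_sub hB] at h
  linarith

end IsDensity

/-- A class of distributions with densities has a countable subset that is dense in total
variation. -/
lemma exists_dense_seq {ν : Measure X} [SFinite ν] [MeasurableSpace.CountablyGenerated X]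
    {F : Set (ProbabilityMeasure X)} (hF : F.Nonempty) {ρ : ProbabilityMeasure X → X → ℝ}
    (hρ : ∀ p ∈ F, IsDensity ν p (ρ p)) :
    ∃ f : ℕ → ProbabilityMeasure X, (∀ k, f k ∈ F) ∧
      ∀ p ∈ F, ∀ η : ℝ, 0 < η → ∃ k, tvDist (f k) p < η := by
  have : Fact ((1 : ENNReal) ≠ ⊤) := ⟨ENNReal.one_ne_top⟩
  have := hF.to_subtype
  -- `L¹(ν)` is separable, hence so is the subset of densities of `F`, which therefore has a dense
  -- sequence of its own members.
  let Φ : F → Lp ℝ 1 ν := fun p => (hρ p.1 p.2).integrable.toL1 (ρ p.1)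
  have hmem : ∀ k, ∃ p : F, Φ p = TopologicalSpace.denseSeq (Set.range Φ) k :=
    fun k => (TopologicalSpace.denseSeq (Set.range Φ) k).2
  choose f hf using hmem
  refine ⟨fun k => (f k).1, fun k => (f k).2, fun p hp η hη => ?_⟩
  obtain ⟨k, hk⟩ := (TopologicalSpace.denseRange_denseSeq (Set.range Φ)).exists_dist_lt
    ⟨Φ ⟨p, hp⟩, Set.mem_range_self _⟩ hη
  refine ⟨k, ((hρ _ (f k).2).tvDist_le_dist (hρ p hp)).trans_lt ?_⟩
  rw [Subtype.dist_eq, ← hf k, dist_comm] at hk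
  exact hk

lemma VCDimLE.comp {X κ κ' : Type*} {A : κ → Set X} {D : ℕ} (hA : VCDimLE A D) (e : κ' → κ) :
    VCDimLE (fun k => A (e k)) D := by
  intro t ht
  refine hA t fun u hu => ?_
  obtain ⟨k, hk⟩ := ht u hu
  exact ⟨e k, hk⟩

/-- The largest deviation of a distribution from the empirical frequencies on a sequence of sets. -/
noncomputable def maxDev {n : ℕ} (A : ℕ → Set X) (S : Fin n → X) (p : ProbabilityMeasure X) : ℝ :=
  ⨆ j, |(p : Measure X).real (A j) - empFreq S (A j)|

lemma abs_real_sub_empFreq_le_maxDev {n : ℕ} (A : ℕ → Set X) (S : Fin n → X)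
    (p : ProbabilityMeasure X) (j : ℕ) :
    |(p : Measure X).real (A j) - empFreq S (A j)| ≤ maxDev A S p := by
  refine le_ciSup (f := fun j => |(p : Measure X).real (A j) - empFreq S (A j)|) ⟨1, ?_⟩ j
  rintro _ ⟨j, rfl⟩
  have h1 : (p : Measure X).real (A j) ≤ 1 := measureReal_le_one
  have h3 : 0 ≤ (p : Measure X).real (A j) := measureReal_nonneg
  obtain ⟨h4, h5⟩ := empFreq_mem_Icc S (A j)
  rw [abs_le]
  constructor <;> linarith

lemma maxDev_nonneg {n : ℕ} (A : ℕ → Set X) (S : Fin n → X) (p : ProbabilityMeasure X) :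
    0 ≤ maxDev A S p := (abs_nonneg _).trans (abs_real_sub_empFreq_le_maxDev A S p 0)

lemma exists_maxDev_lt {n : ℕ} (A : ℕ → Set X) (f : ℕ → ProbabilityMeasure X) {η : ℝ} (hη : 0 < η)
    (S : Fin n → X) : ∃ k, maxDev A S (f k) < (⨅ l, maxDev A S (f l)) + η :=
  exists_lt_of_ciInf_lt (by linarith)

lemma measurable_maxDev {n : ℕ} {A : ℕ → Set X} (hA : ∀ j, MeasurableSet (A j))
    (p : ProbabilityMeasure X) : Measurable fun S : Fin n → X => maxDev A S p :=
  Measurable.iSup fun j => ((measurable_empFreq (hA j)).const_sub _).abs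

open Classical in
/-- The minimum distance estimate: the first member of a sequence of distributions that minimizes
the largest deviation up to `ε / 32`. -/
noncomputable def minDistLearner {A : ℕ → Set X} (hA : ∀ j, MeasurableSet (A j))
    (f : ℕ → ProbabilityMeasure X) : Learner X where
  output ε _ _ S := if hε : 0 < ε then
    f (Nat.find (exists_maxDev_lt A f (show 0 < ε / 32 by positivity) S)) else f 0
  measurable_output ε δ m := by
    by_cases hε : 0 < ε
    · simp only [hε, dif_pos]
      -- The output factors through the discrete index in `ℕ`, so only the measurability of that
      -- index has to be checked.
      refine (measurable_from_top (f := fun k => (f k : Measure X))).comp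
        (measurable_find (fun S => exists_maxDev_lt A f (show 0 < ε / 32 by positivity) S)
          fun k => ?_)
      exact measurableSet_lt (measurable_maxDev hA _)
        ((Measurable.iInf fun l => measurable_maxDev hA _).add_const _)
    · simp only [hε, dif_neg, not_false_eq_true]
      exact measurable_const

lemma minDistLearner_spec {A : ℕ → Set X} (hA : ∀ j, MeasurableSet (A j))
    (f : ℕ → ProbabilityMeasure X) {ε δ : ℝ} (hε : 0 < ε) {n : ℕ} (S : Fin n → X) :
    ∃ k, (minDistLearner hA f).output ε δ n S = f k ∧
      ∀ l, maxDev A S (f k) < maxDev A S (f l) + ε / 32 := by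
  classical
  refine ⟨_, dif_pos hε, fun l => ?_⟩
  have hbdd : BddBelow (Set.range fun l => maxDev A S (f l)) :=
    ⟨0, by rintro _ ⟨l, rfl⟩; exact maxDev_nonneg _ _ _⟩
  have h1 := ciInf_le hbdd l
  have h2 := Nat.find_spec (exists_maxDev_lt A f (show 0 < ε / 32 by positivity) S)
  refine h2.trans_le ?_
  linarith

/-- A class of distributions whose Yatracos class has VC dimension at most `D` is `3`-agnostic
learnable with `O((D + log (1 / δ)) / ε ^ 2)` samples. -/
theorem exists_learner_of_vcDimLE {ν : Measure X} [SFinite ν]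
    [MeasurableSpace.CountablyGenerated X] {F : Set (ProbabilityMeasure X)} (hF : F.Nonempty)
    {ρ : ProbabilityMeasure X → X → ℝ} (hρ : ∀ p ∈ F, IsDensity ν p (ρ p)) {D : ℕ} (hD1 : 1 ≤ D)
    (hD : VCDimLE (fun k : F × F => {x | ρ k.2 x < ρ k.1 x}) D) :
    ∃ L : Learner X, ∀ (g : ProbabilityMeasure X) (ε δ : ℝ) (n : ℕ), 0 < ε → 0 < δ → δ ≤ 1 →
      128 ^ 2 * (D + 1 + Real.log (1 / δ)) ≤ n * (ε / 8) ^ 2 →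
      (Measure.pi fun _ : Fin n => (g : Measure X))
        {S | ¬ IsApproximation F ε 3 (L.output ε δ n S) g} ≤ ENNReal.ofReal δ := by
  obtain ⟨f, hfF, hdense⟩ := exists_dense_seq hF hρ
  let A : ℕ → Set X := fun j => {x | ρ (f j.unpair.2) x < ρ (f j.unpair.1) x}
  have hA : ∀ j, MeasurableSet (A j) := fun j =>
    measurableSet_lt (hρ _ (hfF _)).measurable (hρ _ (hfF _)).measurable
  have hvc : VCDimLE A D := hD.comp fun j : ℕ => (⟨f j.unpair.1, hfF _⟩, ⟨f j.unpair.2, hfF _⟩)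
  refine ⟨minDistLearner hA f, fun g ε δ n hε hδ hδ1 hn => ?_⟩
  refine le_trans (measure_mono fun S hS => ?_)
    (measure_exists_empFreq_sub_gt_le_of_vcDimLE (g : Measure X) hA hD1 hvc
      (show 0 < ε / 8 by positivity) hδ hδ1 hn)
  by_contra hcon
  refine hS ?_
  simp only [Set.mem_ofPred_eq, not_exists, not_lt] at hcon
  obtain ⟨k, hk, hmin⟩ := minDistLearner_spec hA f (δ := δ) hε S
  rw [hk]
  obtain ⟨f₀, hf₀, hopt⟩ := exists_l1Dist_lt g hF (show 0 < ε / 32 by positivity)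
  obtain ⟨l, hl⟩ := hdense f₀ hf₀ (ε / 32) (by positivity)
  have h1 : tvDist (f l) g ≤ ε / 32 + tvDist f₀ g :=
    (tvDist_triangle _ f₀ _).trans (by linarith)
  have h2 : maxDev A S (f l) ≤ tvDist (f l) g + ε / 8 := by
    refine ciSup_le fun j => (abs_sub_le _ ((g : Measure X).real (A j)) _).trans ?_
    refine add_le_add (abs_real_sub_real_le_tvDist _ _ (hA j)) ?_
    rw [abs_sub_comm]
    exact hcon j
  -- The set where `f k` has the larger density is itself one of the `A j`, so both deviations on it
  -- are controlled.
  have h3 : tvDist (f k) (f l) ≤ maxDev A S (f k) + maxDev A S (f l) := by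
    refine ((hρ _ (hfF k)).tvDist_le_of_setOf_lt (hρ _ (hfF l))).trans ?_
    have hAj : {x | ρ (f l) x < ρ (f k) x} = A (Nat.pair k l) := by simp [A]
    rw [hAj]
    refine (abs_sub_le _ (empFreq S (A (Nat.pair k l))) _).trans ?_
    refine add_le_add (abs_real_sub_empFreq_le_maxDev _ _ _ _) ?_
    rw [abs_sub_comm]
    exact abs_real_sub_empFreq_le_maxDev _ _ _ _
  have h4 := tvDist_triangle (f k) (f l) g
  have h5 := hmin l
  unfold IsApproximation
  unfold l1Dist at hopt ⊢
  linarith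

end DistLearn

/-! ### Gaussian densities as exponentials of quadratic polynomials. -/

namespace DistLearn

open scoped RealInnerProductSpace

section GaussianDensity

variable {d : ℕ}

/-- Both sides have the same characteristic function, by the Gaussian Fourier integral. The value of
`c` is irrelevant later: its logarithm only enters a constant coefficient. -/
lemma stdGaussian_eq_withDensity :
    ∃ c : ℝ, 0 < c ∧ stdGaussian (EuclideanSpace ℝ (Fin d)) =
      volume.withDensity fun x => ENNReal.ofReal (c * Real.exp (-(1 / 2) * ‖x‖ ^ 2)) := by
  set E := EuclideanSpace ℝ (Fin d)
  set Z : ℝ := ∫ x : E, Real.exp (-(1 / 2) * ‖x‖ ^ 2) with hZ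
  have hZpos : 0 < Z := by
    rw [hZ, GaussianFourier.integral_rexp_neg_mul_sq_norm (by norm_num)]
    positivity
  have hint : Integrable fun x : E => Real.exp (-(1 / 2) * ‖x‖ ^ 2) := by
    by_contra h
    rw [hZ, integral_undef h] at hZpos
    exact lt_irrefl _ hZpos
  have hnn : ∀ x : E, 0 ≤ Z⁻¹ * Real.exp (-(1 / 2) * ‖x‖ ^ 2) := fun x => by positivity
  refine ⟨Z⁻¹, inv_pos.2 hZpos, ?_⟩
  have : IsFiniteMeasure ((volume : Measure E).withDensity fun x =>
      ENNReal.ofReal (Z⁻¹ * Real.exp (-(1 / 2) * ‖x‖ ^ 2))) :=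
    isFiniteMeasure_withDensity_ofReal (hint.const_mul _).2
  refine Measure.ext_of_charFun ?_
  ext t
  have h0 := GaussianFourier.integral_cexp_neg_mul_sq_norm (V := E) (b := 1 / 2) (by norm_num)
  have ht := GaussianFourier.integral_cexp_neg_mul_sq_norm_add (V := E) (b := 1 / 2) (by norm_num)
    Complex.I t
  have hZc : ∫ x : E, Complex.exp (-(1 / 2) * ‖x‖ ^ 2) = (Z : ℂ) := by
    rw [hZ, ← integral_complex_ofReal]
    congr with x
    push_cast
    rfl
  rw [charFun_stdGaussian, charFun_apply, integral_withDensity_eq_integral_toReal_smul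
    (by fun_prop) (.of_forall fun _ => ENNReal.ofReal_lt_top)]
  have hcongr : ∀ x : E, (ENNReal.ofReal (Z⁻¹ * Real.exp (-(1 / 2) * ‖x‖ ^ 2))).toReal •
      Complex.exp (⟪x, t⟫ * Complex.I) =
      (Z⁻¹ : ℂ) * Complex.exp (-(1 / 2) * ‖x‖ ^ 2 + Complex.I * ⟪t, x⟫) := by
    intro x
    rw [ENNReal.toReal_ofReal (hnn x), Complex.real_smul, Complex.exp_add, real_inner_comm]
    push_cast
    ring_nf
  simp_rw [hcongr]
  rw [integral_const_mul, ht, ← h0, hZc, ← mul_assoc, inv_mul_cancel₀ (by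
    exact_mod_cast hZpos.ne'), one_mul, Complex.I_sq]
  congr 1
  ring

lemma map_affine_withDensity {E : Type*} [NormedAddCommGroup E] [NormedSpace ℝ E]
    [MeasurableSpace E] [BorelSpace E] [FiniteDimensional ℝ E] (ν : Measure E)
    [ν.IsAddHaarMeasure] (μ : E) {T R : E →L[ℝ] E} (hRT : ∀ x, R (T x) = x) {ρ : E → ℝ}
    (hρ : Measurable ρ) :
    ∃ k : ℝ, 0 < k ∧ (ν.withDensity fun x => ENNReal.ofReal (ρ x)).map (fun x => μ + T x) =
      ν.withDensity fun x => ENNReal.ofReal (k * ρ (R (x - μ))) := by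
  have hdet : LinearMap.det (T : E →ₗ[ℝ] E) ≠ 0 := by
    intro h
    have h1 : (R : E →ₗ[ℝ] E) ∘ₗ (T : E →ₗ[ℝ] E) = LinearMap.id := by
      ext x
      exact hRT x
    have h2 := congrArg LinearMap.det h1
    rw [LinearMap.det_comp, h, LinearMap.det_id, mul_zero] at h2
    exact zero_ne_one h2
  set k : ℝ := |(LinearMap.det (T : E →ₗ[ℝ] E))⁻¹| with hk
  have hkpos : 0 < k := abs_pos.2 (inv_ne_zero hdet)
  have he : Measurable fun x => μ + T x := by fun_prop
  have hmap : ν.map (fun x => μ + T x) = ENNReal.ofReal k • ν := by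
    have h1 : (fun x => μ + T x) = (fun x => μ + x) ∘ (T : E →ₗ[ℝ] E) := rfl
    have h2 : Measurable (T : E →ₗ[ℝ] E) := T.continuous.measurable
    rw [h1, ← Measure.map_map (measurable_const_add μ) h2,
      Measure.map_linearMap_addHaar_eq_smul_addHaar ν hdet, Measure.map_smul,
      (measurePreserving_add_left ν μ).map_eq]
  refine ⟨k, hkpos, Measure.ext fun B hB => ?_⟩
  have hm : Measurable fun x => ENNReal.ofReal (ρ (R (x - μ))) := by fun_prop
  rw [Measure.map_apply he hB, withDensity_apply _ (he hB), withDensity_apply _ hB]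
  calc ∫⁻ x in (fun x => μ + T x) ⁻¹' B, ENNReal.ofReal (ρ x) ∂ν
      = ∫⁻ x in (fun x => μ + T x) ⁻¹' B, ENNReal.ofReal (ρ (R (μ + T x - μ))) ∂ν := by
        simp_rw [add_sub_cancel_left, hRT]
    _ = ∫⁻ y in B, ENNReal.ofReal (ρ (R (y - μ))) ∂(ν.map fun x => μ + T x) :=
        (setLIntegral_map hB hm he).symm
    _ = ∫⁻ y in B, ENNReal.ofReal (k * ρ (R (y - μ))) ∂ν := by
        rw [hmap, Measure.restrict_smul, lintegral_smul_measure, smul_eq_mul,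
          ← lintegral_const_mul _ hm]
        simp_rw [ENNReal.ofReal_mul hkpos.le]

lemma multivariateGaussian_eq_withDensity (μ : EuclideanSpace ℝ (Fin d))
    {S : Matrix (Fin d) (Fin d) ℝ} (hS : S.PosDef) :
    ∃ (c : ℝ) (R : EuclideanSpace ℝ (Fin d) →L[ℝ] EuclideanSpace ℝ (Fin d)), 0 < c ∧
      multivariateGaussian μ S = volume.withDensity fun x =>
        ENNReal.ofReal (c * Real.exp (-(1 / 2) * ‖R (x - μ)‖ ^ 2)) := by
  classical
  open scoped MatrixOrder in
  have hsq : CFC.sqrt S * CFC.sqrt S = S := CFC.sqrt_mul_sqrt_self _ hS.posSemidef.nonneg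
  have hdet : IsUnit S.det := (Matrix.isUnit_iff_isUnit_det S).1 hS.isUnit
  set T := Matrix.toEuclideanCLM (𝕜 := ℝ) (CFC.sqrt S) with hT
  -- `S⁻¹ * √S` is the inverse of `√S`.
  set R := Matrix.toEuclideanCLM (𝕜 := ℝ) (S⁻¹ * CFC.sqrt S) with hR
  have hRT : ∀ x, R (T x) = x := by
    intro x
    have : R * T = 1 := by
      rw [hR, hT, ← map_mul, mul_assoc, hsq, Matrix.nonsing_inv_mul _ hdet, map_one]
    exact congrArg (fun f : EuclideanSpace ℝ (Fin d) →L[ℝ] EuclideanSpace ℝ (Fin d) => f x) this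
  obtain ⟨c, hc, hstd⟩ := stdGaussian_eq_withDensity (d := d)
  obtain ⟨k, hk, hmap⟩ := map_affine_withDensity (volume : Measure (EuclideanSpace ℝ (Fin d))) μ hRT
    (ρ := fun x => c * Real.exp (-(1 / 2) * ‖x‖ ^ 2)) (by fun_prop)
  refine ⟨k * c, R, by positivity, ?_⟩
  rw [multivariateGaussian, hstd, hmap]
  simp_rw [mul_assoc]

/-- The monomials of degree at most two, indexed (with repetitions) by pairs of variables, where
`none` stands for the constant `1`. -/
noncomputable def quadraticMonomials (x : EuclideanSpace ℝ (Fin d))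
    (j : Option (Fin d) × Option (Fin d)) : ℝ :=
  j.1.elim 1 (fun i => x i) * j.2.elim 1 (fun i => x i)

lemma exists_norm_sq_affine_eq (μ : EuclideanSpace ℝ (Fin d))
    (R : EuclideanSpace ℝ (Fin d) →L[ℝ] EuclideanSpace ℝ (Fin d)) (c b : ℝ) :
    ∃ a : Option (Fin d) × Option (Fin d) → ℝ, ∀ x,
      b + c * ‖R (x - μ)‖ ^ 2 = ∑ j, a j * quadraticMonomials x j := by
  let β : Fin d → Option (Fin d) → ℝ := fun i o =>
    o.elim (-(R μ) i) fun l => (R (EuclideanSpace.single l 1)) i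
  have hβ : ∀ x i, (R (x - μ)) i = ∑ o, β i o * o.elim 1 (fun l => x l) := by
    intro x i
    have hx : x = ∑ l, x l • EuclideanSpace.single l (1 : ℝ) := by
      ext m
      simp [Finset.sum_apply, Pi.single_apply]
    have h1 : (R x) i = ∑ l, x l * (R (EuclideanSpace.single l 1)) i := by
      conv_lhs => rw [hx]
      simp [map_sum]
    rw [Fintype.sum_option, map_sub, PiLp.sub_apply, h1]
    simp only [β, Option.elim_none, Option.elim_some, mul_one]
    rw [sub_eq_neg_add]
    congr 1
    exact Finset.sum_congr rfl fun l _ => mul_comm _ _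
  refine ⟨fun j => (if j = (none, none) then b else 0) + c * ∑ i, β i j.1 * β i j.2, fun x => ?_⟩
  simp_rw [add_mul, Finset.sum_add_distrib]
  congr 1
  · simp [quadraticMonomials]
  · rw [EuclideanSpace.real_norm_sq_eq, Fintype.sum_prod_type]
    simp_rw [hβ, sq, Finset.sum_mul_sum, Finset.mul_sum, Finset.sum_mul]
    rw [Finset.sum_comm]
    refine Finset.sum_congr rfl fun o _ => ?_
    rw [Finset.sum_comm]
    refine Finset.sum_congr rfl fun o' _ => Finset.sum_congr rfl fun i _ => ?_
    simp only [quadraticMonomials]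
    ring

/-- The density of a Gaussian is the exponential of a quadratic polynomial. -/
lemma exists_isDensity_exp_of_mem_gaussians {f : ProbabilityMeasure (EuclideanSpace ℝ (Fin d))}
    (hf : f ∈ gaussians d) : ∃ a : Option (Fin d) × Option (Fin d) → ℝ,
      IsDensity volume f fun x => Real.exp (∑ j, a j * quadraticMonomials x j) := by
  obtain ⟨μ, S, hS, hfS⟩ := hf
  obtain ⟨c, R, hc, h⟩ := multivariateGaussian_eq_withDensity μ hS
  obtain ⟨a, ha⟩ := exists_norm_sq_affine_eq μ R (-(1 / 2)) (Real.log c)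
  have hexp : (fun x => Real.exp (∑ j, a j * quadraticMonomials x j)) =
      fun x => c * Real.exp (-(1 / 2) * ‖R (x - μ)‖ ^ 2) := by
    funext x
    rw [← ha, Real.exp_add, Real.exp_log hc]
  refine ⟨a, ?_⟩
  rw [hexp]
  exact ⟨by fun_prop, fun x => by positivity, hfS.trans h⟩

lemma gaussians_nonempty : (gaussians d).Nonempty :=
  ⟨⟨multivariateGaussian 0 1, inferInstance⟩, 0, 1, Matrix.PosDef.one, rfl⟩

end GaussianDensity

/-! ### Learning Gaussians, and the choice of the sample size. -/

theorem exists_learner_gaussians (d : ℕ) :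
    ∃ L : Learner (EuclideanSpace ℝ (Fin d)),
      ∀ (g : ProbabilityMeasure (EuclideanSpace ℝ (Fin d))) (ε δ : ℝ) (n : ℕ), 0 < ε → 0 < δ →
        δ ≤ 1 → 128 ^ 2 * (((d : ℝ) + 1) ^ 2 + 1 + Real.log (1 / δ)) ≤ n * (ε / 8) ^ 2 →
        (Measure.pi fun _ : Fin n => (g : Measure (EuclideanSpace ℝ (Fin d))))
          {S | ¬ IsApproximation (gaussians d) ε 3 (L.output ε δ n S) g} ≤ ENNReal.ofReal δ := by
  classical
  choose! a ha using fun (f : ProbabilityMeasure (EuclideanSpace ℝ (Fin d))) (hf : f ∈ gaussians d) =>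
    exists_isDensity_exp_of_mem_gaussians hf
  have hvc : VCDimLE (fun k : gaussians d × gaussians d =>
      {x | Real.exp (∑ j, a k.2 j * quadraticMonomials x j) <
        Real.exp (∑ j, a k.1 j * quadraticMonomials x j)}) ((d + 1) ^ 2) := by
    have h := vcDimLE_setOf_pos quadraticMonomials
      fun (k : gaussians d × gaussians d) j => a k.1 j - a k.2 j
    have hcard : Fintype.card (Option (Fin d) × Option (Fin d)) = (d + 1) ^ 2 := by
      simp [sq]
    rw [hcard] at h
    -- By monotonicity of `exp`, comparing densities is asking for the sign of a difference of
    -- polynomials.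
    simpa only [Real.exp_lt_exp, sub_mul, Finset.sum_sub_distrib, sub_pos] using h
  obtain ⟨L, hL⟩ := exists_learner_of_vcDimLE gaussians_nonempty ha (Nat.one_le_pow _ _ d.succ_pos) hvc
  refine ⟨L, fun g ε δ n hε hδ hδ1 hn => hL g ε δ n hε hδ hδ1 ?_⟩
  push_cast
  exact hn

/-- Needed for `d = 0`, where the claimed bound is `K * log (1 / δ) / ε ^ 2` and may be less than
`1`. -/
lemma isApproximation_of_subsingleton {X : Type*} [MeasurableSpace X] [Subsingleton X]
    (F : Set (ProbabilityMeasure X)) {ε C : ℝ} (hC : 0 ≤ C) (hε : 0 ≤ ε)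
    (p g : ProbabilityMeasure X) : IsApproximation F ε C p g := by
  have h1 : tvDist p g ≤ 0 := tvDist_le fun B _ => by
    rcases Set.eq_empty_or_nonempty B with rfl | hB
    · simp
    · rw [Subsingleton.eq_univ_of_nonempty hB]
      simp
  have h2 := mul_nonneg hC (opt_nonneg g F)
  unfold IsApproximation l1Dist
  linarith

end DistLearn

theorem mainTheorem5 :
    ∃ K : ℝ, 0 < K ∧ ∀ d : ℕ, ∃ m : ℝ → ℝ → ℕ,
      DistLearn.AgnosticPACLearnable 3 (DistLearn.gaussians d) m ∧
      ∀ ε δ : ℝ, 0 < ε → 0 < δ → δ < 1 →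
        (m ε δ : ℝ) ≤ K * (((d : ℝ) ^ 2 + Real.log (1 / δ)) / ε ^ 2) := by
  classical
  refine ⟨2 ^ 23, by norm_num, fun d => ?_⟩
  obtain ⟨L, hL⟩ := DistLearn.exists_learner_gaussians d
  -- `2 ^ 20 = 128 ^ 2 * 8 ^ 2`, and `(d + 1) ^ 2 + 1 ≤ 5 * d ^ 2` for `d ≥ 1`. The remaining room
  -- up to `2 ^ 23` absorbs the rounding, since `ε ^ 2 < 4 ≤ 4 * d ^ 2` outside the trivial cases.
  refine ⟨fun ε δ => if d = 0 ∨ 2 ≤ ε ∨ 1 ≤ δ then 0 else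
    ⌈2 ^ 20 * (5 * (d : ℝ) ^ 2 + Real.log (1 / δ)) / ε ^ 2⌉₊, ⟨L, fun g ε δ hε hδ => ?_⟩,
    fun ε δ hε hδ hδ1 => ?_⟩
  · by_cases hδ1 : 1 ≤ δ
    · exact prob_le_one.trans (by simpa using hδ1)
    by_cases hd : d = 0
    · subst hd
      simp [DistLearn.isApproximation_of_subsingleton (DistLearn.gaussians 0)
        (show (0 : ℝ) ≤ 3 by norm_num) hε.le]
    by_cases hε2 : 2 ≤ ε
    · simp [DistLearn.isApproximation_of_two_le _ _ (DistLearn.gaussians d)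
        (show (0 : ℝ) ≤ 3 by norm_num) hε2]
    refine hL g ε δ _ hε hδ (not_le.1 hδ1).le ?_
    simp only [hd, hε2, hδ1, or_self, if_false]
    have hd1 : (1 : ℝ) ≤ d := by exact_mod_cast Nat.one_le_iff_ne_zero.2 hd
    have h1 := Nat.le_ceil (2 ^ 20 * (5 * (d : ℝ) ^ 2 + Real.log (1 / δ)) / ε ^ 2)
    rw [div_le_iff₀ (by positivity)] at h1
    have h2 : ((d : ℝ) + 1) ^ 2 + 1 ≤ 5 * (d : ℝ) ^ 2 := by nlinarith
    rw [div_pow]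
    linarith
  · have hL0 : 0 ≤ Real.log (1 / δ) := Real.log_nonneg (by rw [le_div_iff₀ hδ]; linarith)
    beta_reduce
    split_ifs with h
    · rw [Nat.cast_zero]
      positivity
    · simp only [not_or, not_le] at h
      obtain ⟨hd, hε2, -⟩ := h
      have hd1 : (1 : ℝ) ≤ d := by exact_mod_cast Nat.one_le_iff_ne_zero.2 hd
      have h1 := (Nat.ceil_lt_add_one (a := 2 ^ 20 * (5 * (d : ℝ) ^ 2 + Real.log (1 / δ)) / ε ^ 2)
        (by positivity)).le
      refine h1.trans ?_
      rw [← mul_div_assoc, le_div_iff₀ (by positivity), add_mul, div_mul_cancel₀ _ (by positivity)]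
      nlinarith
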